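/- For every $n \ge 1$ let $\rho_n : SU(2) \to U(E_n)$ be an irreducible unitary representation of the Lie group $SU(2)$ (differentiable at the identity, equivalently continuous) on a complex Hilbert space $E_n$ of dimension $n$. Let $\sigma_x, \sigma_y, \sigma_z$ be the Pauli matrices, and let $$J_k = i\,\frac{d}{dt}\Big|_{t=0}\, \rho_n\!\left(e^{-\frac{i}{2} t \sigma_k}\right), \qquad k \in \{x,y,z\},$$ be the corresponding self-adjoint generators, which satisfy $[J_x,J_y] = iJ_z$, $[J_y,J_z] = iJ_x$, $[J_z,J_x] = iJ_y$. Let $$C_n = \left[\mathbb{1}_{(0,\infty)}(J_x),\ \mathbb{1}_{(0,\infty)}(J_z)\right],$$ where $\mathbb{1}_{(0,\infty)}$ is the indicator function of $(0,\infty) \subset \mathbb{R}$, applied by the functional calculus of self-adjoint operators (so that $\mathbb{1}_{(0,\infty)}(J_k)$ is the orthogonal projection onto the span of all eigenvectors of $J_k$ with positive eigenvalue), and $[A,B]=AB-BA$. Then $$\lim_{n\to\infty} \Vert C_n \Vert_{\mathrm{op}} = \frac12 .$$ -/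

import Mathlib

namespace SpinCommutator

/-- The Pauli matrices `σ_x, σ_y, σ_z`, indexed by `0, 1, 2`. -/
def pauli : Fin 3 → Matrix (Fin 2) (Fin 2) ℂ :=
  ![!![0, 1; 1, 0], !![0, -Complex.I; Complex.I, 0], !![1, 0; 0, -1]]

/-- The element `-(i/2) (a₀ σ_x + a₁ σ_y + a₂ σ_z)` of the Lie algebra `su(2)`. -/
noncomputable def su2 (a : Fin 3 → ℝ) : Matrix (Fin 2) (Fin 2) ℂ :=
  (-(Complex.I / 2)) • ∑ k, (a k : ℂ) • pauli k

lemma su2_eq (a : Fin 3 → ℝ) :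
    su2 a = !![-(Complex.I / 2) * a 2, -(Complex.I / 2) * (a 0 - Complex.I * a 1);
      -(Complex.I / 2) * (a 0 + Complex.I * a 1), (Complex.I / 2) * a 2] := by
  ext i j
  fin_cases i <;> fin_cases j <;> simp [su2, pauli, Fin.sum_univ_three] <;> ring

lemma conjTranspose_su2 (a : Fin 3 → ℝ) : (su2 a).conjTranspose = -su2 a := by
  rw [su2_eq]
  ext i j
  fin_cases i <;> fin_cases j <;>
    simp [Matrix.conjTranspose_apply] <;> ring

lemma exp_mul_exp_neg_su2 (a : Fin 3 → ℝ) :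
    NormedSpace.exp (su2 a) * NormedSpace.exp (-su2 a) = 1 := by
  rw [← Matrix.exp_add_of_commute _ _ (Commute.refl (su2 a)).neg_right, add_neg_cancel,
    NormedSpace.exp_zero]

lemma exp_su2_mem (a : Fin 3 → ℝ) :
    NormedSpace.exp (su2 a) ∈ Matrix.specialUnitaryGroup (Fin 2) ℂ := by
  rw [Matrix.mem_specialUnitaryGroup_iff, Matrix.mem_unitaryGroup_iff]
  constructor
  · rw [Matrix.star_eq_conjTranspose, ← Matrix.exp_conjTranspose, conjTranspose_su2,
      exp_mul_exp_neg_su2]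
  · set S : Matrix (Fin 2) (Fin 2) ℂ := !![0, 1; -1, 0] with hS
    have hdet : S.det = 1 := by simp [hS, Matrix.det_fin_two]
    have hSu : IsUnit S := by
      rw [Matrix.isUnit_iff_isUnit_det, hdet]
      exact isUnit_one
    have hSinv : S⁻¹ = !![0, -1; 1, 0] := by
      rw [Matrix.inv_def, hdet, hS, Matrix.adjugate_fin_two]
      simp
    have h1 : -su2 a = S * (su2 a).transpose * S⁻¹ := by
      rw [hSinv, su2_eq, hS]
      ext i j
      fin_cases i <;> fin_cases j <;> simp [Matrix.mul_apply, Matrix.vecMul, dotProduct, Fin.sum_univ_two]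
    have h2 : NormedSpace.exp (-su2 a) = (NormedSpace.exp (su2 a)).adjugate := by
      rw [h1, Matrix.exp_conj _ _ hSu, Matrix.exp_transpose, hSinv, hS, Matrix.adjugate_fin_two]
      ext i j
      fin_cases i <;> fin_cases j <;> simp [Matrix.mul_apply, Matrix.vecMul, dotProduct, Fin.sum_univ_two]
    have h3 := exp_mul_exp_neg_su2 a
    rw [h2, Matrix.mul_adjugate] at h3
    simpa using congrFun (congrFun h3 0) 0

/-- The group `SU(2)`. -/
abbrev SU2 : Type := Matrix.specialUnitaryGroup (Fin 2) ℂ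

/-- The exponential map `a ↦ exp (-(i/2) (a₀ σ_x + a₁ σ_y + a₂ σ_z))` of `SU(2)`. -/
noncomputable def expSU2 (a : Fin 3 → ℝ) : SU2 :=
  ⟨NormedSpace.exp (su2 a), exp_su2_mem a⟩

section Rep

variable {E : Type*} [NormedAddCommGroup E] [InnerProductSpace ℂ E] [CompleteSpace E]

/-- The linear representation underlying a unitary representation. -/
noncomputable def toRepresentation (ρ : SU2 →* unitary (E →L[ℂ] E)) : Representation ℂ SU2 E :=
  (ContinuousLinearMap.toLinearMapRingHom (R₁ := ℂ) (M₁ := E)).toMonoidHom.comp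
    ((unitary (E →L[ℂ] E)).subtype.comp ρ)

/-- A unitary representation read in exponential coordinates around the identity. -/
noncomputable def inExpCoordinates (ρ : SU2 →* unitary (E →L[ℂ] E)) (a : Fin 3 → ℝ) : E →L[ℂ] E :=
  (ρ (expSU2 a) : E →L[ℂ] E)

/-- `ρ` is differentiable at the identity, so that it has infinitesimal generators. For a
homomorphism into a finite-dimensional unitary group this amounts to continuity, and to
smoothness. -/
def IsDifferentiable (ρ : SU2 →* unitary (E →L[ℂ] E)) : Prop :=
  DifferentiableAt ℝ (inExpCoordinates ρ) 0

/-- The generator `J_k = i ∂/∂a_k ρ (exp (-(i/2) a · σ))` at `a = 0`; the generators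
`J_x, J_y, J_z` are indexed by `0, 1, 2`. -/
noncomputable def J (ρ : SU2 →* unitary (E →L[ℂ] E)) (k : Fin 3) : E →L[ℂ] E :=
  Complex.I • fderiv ℝ (inExpCoordinates ρ) 0 (Pi.single k 1)

/-- The spectral projection `1_{(0,∞)}(A)`, by the functional calculus of self-adjoint
operators. -/
noncomputable def positiveProjection (A : E →L[ℂ] E) : E →L[ℂ] E :=
  cfc ((Set.Ioi (0 : ℝ)).indicator fun _ => (1 : ℝ)) A

/-- The commutator `[1_{(0,∞)}(J_x), 1_{(0,∞)}(J_z)]`. -/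
noncomputable def C (ρ : SU2 →* unitary (E →L[ℂ] E)) : E →L[ℂ] E :=
  ⁅positiveProjection (J ρ 0), positiveProjection (J ρ 2)⁆

end Rep

end SpinCommutator

/-!
The commutator of two projections `P, Q` is a quarter of that of the contractions `2 P - 1` and
`2 Q - 1`, so its norm is at most `1 / 2`.

For the lower bound let `e k` and `f l` be the weight bases for `J_z` and `J_x`, and let `P` be the
positive projection of `J_x`. Since `J_z` is tridiagonal in the basis `f`, `⁅J_z, P⁆` has rank two,
and `(k - k') * ⟪e k, P (e k')⟫` is a `2 × 2` minor built from the two middle columns of the overlap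
matrix `⟪e k, f l⟫`, as in the Christoffel–Darboux formula. The rotation symmetries of the overlaps
make the minor a product `g k * h k'` when `k` is odd and `k'` even, and central binomial
coefficients show that `‖g k‖ * ‖h k'‖` tends to at least `1 / π` near the middle. The commutator
therefore contains, up to phases, arbitrarily large blocks of the Hilbert-type matrix
`1 / (π (k - k')) = 1 / (π (2 (s + t) + 5))`, and these have norms approaching `1 / 2`.
-/

namespace SpinCommutator

open ComplexConjugate

section SU2

lemma su2_add (a b : Fin 3 → ℝ) : su2 (a + b) = su2 a + su2 b := by
  simp [su2, add_smul, Finset.sum_add_distrib]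

lemma su2_smul (t : ℝ) (a : Fin 3 → ℝ) : su2 (t • a) = t • su2 a := by
  simp only [su2, Pi.smul_apply, smul_eq_mul, Complex.ofReal_mul, mul_smul, Complex.coe_smul,
    ← Finset.smul_sum]
  exact smul_comm _ _ _

lemma su2_neg (a : Fin 3 → ℝ) : su2 (-a) = -su2 a := by
  simpa using su2_smul (-1) a

lemma su2_single (k : Fin 3) : su2 (Pi.single k 1) = (-(Complex.I / 2)) • pauli k := by
  simp [su2, Pi.single_apply]

lemma su2_mul_self (a : Fin 3 → ℝ) :
    su2 a * su2 a = -((a 0 ^ 2 + a 1 ^ 2 + a 2 ^ 2) / 4) • (1 : Matrix (Fin 2) (Fin 2) ℂ) := by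
  rw [su2_eq]
  ext i j
  fin_cases i <;> fin_cases j <;> apply Complex.ext <;>
    simp [Matrix.mul_apply, Fin.sum_univ_two, pow_two] <;> ring

lemma expSU2_add_smul (s t : ℝ) (a : Fin 3 → ℝ) :
    expSU2 ((s + t) • a) = expSU2 (s • a) * expSU2 (t • a) := by
  apply Subtype.ext
  change NormedSpace.exp _ = NormedSpace.exp _ * NormedSpace.exp _
  rw [add_smul, su2_add, su2_smul, su2_smul, Matrix.exp_add_of_commute]
  exact ((Commute.refl (su2 a)).smul_left s).smul_right t

lemma expSU2_zero : expSU2 0 = 1 := by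
  simpa using expSU2_add_smul 0 0 0

lemma expSU2_neg (a : Fin 3 → ℝ) : expSU2 (-a) = (expSU2 a)⁻¹ := by
  rw [eq_inv_iff_mul_eq_one]
  simpa [expSU2_zero] using (expSU2_add_smul (-1) 1 a).symm

/-- The coordinates of a traceless anti-Hermitian matrix with respect to `-(i/2) σ`, as a linear
map on all matrices; it is inverse to `su2`. -/
noncomputable def su2Coord : Matrix (Fin 2) (Fin 2) ℂ →ₗ[ℝ] (Fin 3 → ℝ) where
  toFun M := ![-2 * (M 0 1).im, -2 * (M 0 1).re, -2 * (M 0 0).im]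
  map_add' M N := by ext i; fin_cases i <;> simp <;> ring
  map_smul' t M := by ext i; fin_cases i <;> simp <;> ring

lemma su2Coord_su2 (a : Fin 3 → ℝ) : su2Coord (su2 a) = a := by
  rw [su2_eq]
  ext i
  fin_cases i <;> simp [su2Coord]

lemma su2_su2Coord {M : Matrix (Fin 2) (Fin 2) ℂ} (h : M.conjTranspose = -M) (ht : M.trace = 0) :
    su2 (su2Coord M) = M := by
  have h11 : M 1 1 = -M 0 0 := by
    rw [Matrix.trace_fin_two] at ht
    linear_combination ht
  have h10 : M 1 0 = -star (M 0 1) := by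
    simpa using (congrArg Neg.neg (congrFun (congrFun h 1) 0)).symm
  have hre : (M 0 0).re = 0 := by
    have h00 := congrArg Complex.re (congrFun (congrFun h 0) 0)
    simp only [Matrix.conjTranspose_apply, Matrix.neg_apply, Complex.neg_re, RCLike.star_def,
      Complex.conj_re] at h00
    linarith
  rw [su2_eq]
  ext i j
  fin_cases i <;> fin_cases j <;> apply Complex.ext <;> simp [su2Coord, h11, h10, hre]

/-- The adjoint action of `SU(2)` on `su(2)`, in the coordinates `su2`. -/
noncomputable def adjointAction (g : SU2) (a : Fin 3 → ℝ) : Fin 3 → ℝ :=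
  su2Coord ((g : Matrix (Fin 2) (Fin 2) ℂ) * su2 a * (g⁻¹ : SU2))

lemma adjointAction_smul (g : SU2) (t : ℝ) (a : Fin 3 → ℝ) :
    adjointAction g (t • a) = t • adjointAction g a := by
  rw [adjointAction, su2_smul, mul_smul_comm, smul_mul_assoc, map_smul, adjointAction]

lemma su2_adjointAction (g : SU2) (a : Fin 3 → ℝ) :
    su2 (adjointAction g a) = (g : Matrix (Fin 2) (Fin 2) ℂ) * su2 a * (g⁻¹ : SU2) := by
  have hg : ((g⁻¹ : SU2) : Matrix (Fin 2) (Fin 2) ℂ) =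
    (g : Matrix (Fin 2) (Fin 2) ℂ).conjTranspose := rfl
  apply su2_su2Coord
  · simp [hg, Matrix.conjTranspose_mul, conjTranspose_su2, Matrix.mul_assoc]
  · rw [Matrix.trace_mul_cycle, ← Submonoid.coe_mul, inv_mul_cancel, Submonoid.coe_one, one_mul,
      su2_eq, Matrix.trace_fin_two]
    simp

lemma conj_expSU2 (g : SU2) (a : Fin 3 → ℝ) :
    g * expSU2 a * g⁻¹ = expSU2 (adjointAction g a) := by
  apply Subtype.ext
  change (g : Matrix (Fin 2) (Fin 2) ℂ) * NormedSpace.exp (su2 a) * (g⁻¹ : SU2) =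
    NormedSpace.exp (su2 _)
  rw [su2_adjointAction]
  have h1 : (g : Matrix (Fin 2) (Fin 2) ℂ) * (g⁻¹ : SU2) = 1 := by
    rw [← Submonoid.coe_mul, mul_inv_cancel, Submonoid.coe_one]
  have h2 : ((g⁻¹ : SU2) : Matrix (Fin 2) (Fin 2) ℂ) * g = 1 := by
    rw [← Submonoid.coe_mul, inv_mul_cancel, Submonoid.coe_one]
  exact (Matrix.exp_units_conj ⟨_, _, h1, h2⟩ (su2 a)).symm

lemma exp_smul_of_mul_self_eq_neg_one {A : Type*} [NormedRing A] [NormedAlgebra ℝ A]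
    {X : A} (hX : X * X = -1) (t : ℝ) :
    NormedSpace.exp (t • X) = Real.cos t • (1 : A) + Real.sin t • X := by
  let +nondep : NormedAlgebra ℚ A := NormedAlgebra.restrictScalars ℚ ℝ A
  have hc : Continuous (Complex.liftAux X hX) :=
    (Complex.liftAux X hX).toLinearMap.continuous_of_finiteDimensional
  have h := NormedSpace.map_exp (Complex.liftAux X hX) hc (t * Complex.I)
  rw [← Complex.exp_eq_exp_ℂ] at h
  simpa [Complex.liftAux_apply, Complex.exp_ofReal_mul_I_re, Complex.exp_ofReal_mul_I_im,
    Algebra.algebraMap_eq_smul_one] using h.symm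

lemma exists_eq_smul_of_su2_mul_self (b : Fin 3 → ℝ) :
    ∃ (r : ℝ) (a : Fin 3 → ℝ), 0 ≤ r ∧ su2 a * su2 a = -1 ∧ b = r • a := by
  set r : ℝ := √((b 0 ^ 2 + b 1 ^ 2 + b 2 ^ 2) / 4)
  have hr2 : r ^ 2 = (b 0 ^ 2 + b 1 ^ 2 + b 2 ^ 2) / 4 := Real.sq_sqrt (by positivity)
  rcases eq_or_ne r 0 with h0 | h0
  · refine ⟨0, ![2, 0, 0], le_rfl, ?_, ?_⟩
    · rw [su2_mul_self]
      norm_num [show (![2, 0, 0] : Fin 3 → ℝ) 2 = 0 from rfl]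
    · rw [h0] at hr2
      rw [zero_smul]
      ext i
      fin_cases i <;> refine pow_eq_zero_iff two_ne_zero |>.1 ?_ <;> simp <;>
        nlinarith [sq_nonneg (b 0), sq_nonneg (b 1), sq_nonneg (b 2)]
  · refine ⟨r, r⁻¹ • b, Real.sqrt_nonneg _, ?_, by rw [smul_inv_smul₀ h0]⟩
    rw [su2_smul, smul_mul_smul_comm, su2_mul_self, ← hr2, smul_smul]
    field_simp
    simp

lemma star_coe_eq_adjugate (g : SU2) :
    star (g : Matrix (Fin 2) (Fin 2) ℂ) = (g : Matrix (Fin 2) (Fin 2) ℂ).adjugate := by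
  obtain ⟨hU, hdet⟩ := Matrix.mem_specialUnitaryGroup_iff.1 g.2
  rw [← one_mul (star _), ← one_smul ℂ (1 : Matrix _ _ ℂ), ← hdet, ← Matrix.adjugate_mul,
    mul_assoc, Matrix.mem_unitaryGroup_iff.1 hU, mul_one]

lemma exists_eq_smul_one_add_su2 (g : SU2) :
    ∃ (c : ℝ) (b : Fin 3 → ℝ),
      (g : Matrix (Fin 2) (Fin 2) ℂ) = c • (1 : Matrix (Fin 2) (Fin 2) ℂ) + su2 b := by
  set G : Matrix (Fin 2) (Fin 2) ℂ := g.1 with hG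
  set c : ℝ := (G 0 0).re with hc
  have hadj := star_coe_eq_adjugate g
  rw [← hG, Matrix.adjugate_fin_two] at hadj
  have h00 : star (G 0 0) = G 1 1 := congrFun (congrFun hadj 0) 0
  have h2c : G 0 0 + G 1 1 = 2 * c := by
    rw [← h00, RCLike.star_def, Complex.add_conj, hc]
    push_cast; ring
  refine ⟨c, su2Coord (G - c • (1 : Matrix (Fin 2) (Fin 2) ℂ)), ?_⟩
  rw [su2_su2Coord, add_sub_cancel]
  · rw [Matrix.conjTranspose_sub, ← Matrix.star_eq_conjTranspose, hadj]
    ext i j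
    fin_cases i <;> fin_cases j <;> simp <;> linear_combination h2c
  · rw [Matrix.trace_sub, Matrix.trace_smul, Matrix.trace_one, Matrix.trace_fin_two, h2c]
    simp [mul_comm]

attribute [local instance] Matrix.linftyOpNormedRing Matrix.linftyOpNormedAlgebra in
lemma expSU2_surjective : Function.Surjective expSU2 := by
  intro g
  obtain ⟨c, b, hg⟩ := exists_eq_smul_one_add_su2 g
  obtain ⟨r, a, hr, ha, rfl⟩ := exists_eq_smul_of_su2_mul_self b
  have hcr : c ^ 2 + r ^ 2 = 1 := by
    have hmul : (g : Matrix (Fin 2) (Fin 2) ℂ) * star (g : Matrix (Fin 2) (Fin 2) ℂ) = 1 :=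
      Matrix.mem_unitaryGroup_iff.1 (Matrix.mem_specialUnitaryGroup_iff.1 g.2).1
    have hnorm : (g : Matrix (Fin 2) (Fin 2) ℂ) * star (g : Matrix (Fin 2) (Fin 2) ℂ) =
        (c ^ 2 + r ^ 2) • (1 : Matrix (Fin 2) (Fin 2) ℂ) := by
      rw [hg, su2_smul, star_add, star_smul, star_one, star_smul,
        Matrix.star_eq_conjTranspose (su2 a), conjTranspose_su2]
      simp only [add_mul, mul_add, smul_mul_smul_comm, mul_neg, ha, smul_neg, mul_one, one_mul,
        star_trivial, mul_comm r c]
      module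
    have h00 := congrFun (congrFun (hnorm.symm.trans hmul) 0) 0
    exact_mod_cast (by simpa using h00 : (c : ℂ) ^ 2 + (r : ℂ) ^ 2 = 1)
  refine ⟨(Real.arccos c) • a, Subtype.ext ?_⟩
  change NormedSpace.exp (su2 _) = _
  rw [su2_smul]
  refine (exp_smul_of_mul_self_eq_neg_one ha _).trans ?_
  rw [hg, su2_smul,
    Real.cos_arccos (by nlinarith) (by nlinarith), Real.sin_arccos, ← hcr, add_sub_cancel_left,
    Real.sqrt_sq hr]

end SU2

section Exponential

variable {A : Type*} [NormedRing A] [NormedAlgebra ℝ A] [CompleteSpace A]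

lemma hasDerivAt_exp_mul_exp_neg (X Y : A) :
    HasDerivAt (fun t : ℝ => NormedSpace.exp (t • X) * Y * NormedSpace.exp (-(t • X)))
      ⁅X, Y⁆ 0 := by
  have h1 : HasDerivAt (fun t : ℝ => NormedSpace.exp (t • X)) X 0 := by
    simpa using hasDerivAt_exp_smul_const (𝕂 := ℝ) X (0 : ℝ)
  have h2 : HasDerivAt (fun t : ℝ => NormedSpace.exp (-(t • X))) (-X) 0 := by
    simpa using hasDerivAt_exp_smul_const (𝕂 := ℝ) (-X) (0 : ℝ)
  simpa [sub_eq_add_neg, Ring.lie_def, Pi.mul_def] using (h1.mul_const Y).mul h2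

lemma eq_exp_of_hasDerivAt {f : ℝ → A} {D : A} (h0 : f 0 = 1)
    (hf : ∀ t, HasDerivAt f (f t * D) t) (t : ℝ) : f t = NormedSpace.exp (t • D) := by
  let +nondep : NormedAlgebra ℚ A := NormedAlgebra.restrictScalars ℚ ℝ A
  have hderiv : ∀ s : ℝ, HasDerivAt (fun s => f s * NormedSpace.exp (s • -D)) 0 s := by
    intro s
    have h := (hf s).mul (hasDerivAt_exp_smul_const' (𝕂 := ℝ) (-D) s)
    rwa [mul_assoc, ← mul_add, neg_mul, add_neg_cancel, mul_zero] at h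
  have hconst : f t * NormedSpace.exp (t • -D) = 1 := by
    simpa [h0] using is_const_of_deriv_eq_zero (fun s => (hderiv s).differentiableAt)
      (fun s => (hderiv s).deriv) t 0
  have hinv : NormedSpace.exp (t • -D) * NormedSpace.exp (t • D) = 1 := by
    rw [smul_neg, ← NormedSpace.exp_add_of_commute ((Commute.refl (t • D)).neg_left),
      neg_add_cancel, NormedSpace.exp_zero]
  rw [← mul_one (f t), ← hinv, ← mul_assoc, hconst, one_mul]

lemma exp_apply_mem {E : Type*} [NormedAddCommGroup E] [NormedSpace ℂ E] [CompleteSpace E]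
    {W : Submodule ℂ E} (hclosed : IsClosed (W : Set E)) {T : E →L[ℂ] E}
    (hT : ∀ w ∈ W, T w ∈ W) {w : E} (hw : w ∈ W) : NormedSpace.exp T w ∈ W := by
  have hpow : ∀ m : ℕ, (T ^ m) w ∈ W := by
    intro m
    induction m with
    | zero => simpa using hw
    | succ m ih => rw [pow_succ']; exact hT _ ih
  have hsum := (ContinuousLinearMap.apply ℂ E w).hasSum
    (NormedSpace.exp_series_hasSum_exp' (𝕂 := ℂ) T)
  exact hclosed.mem_of_tendsto hsum
    (Filter.Eventually.of_forall fun s => W.sum_mem fun m _ => W.smul_mem _ (hpow m))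

end Exponential

section SpinTriple

variable {E : Type*} [NormedAddCommGroup E] [InnerProductSpace ℂ E] [CompleteSpace E]

/-- Spin operators: self-adjoint operators satisfying the commutation relations of angular
momentum. -/
structure IsSpinTriple (X Y Z : E →L[ℂ] E) : Prop where
  isSelfAdjoint_X : IsSelfAdjoint X
  isSelfAdjoint_Y : IsSelfAdjoint Y
  isSelfAdjoint_Z : IsSelfAdjoint Z
  lie_X_Y : ⁅X, Y⁆ = Complex.I • Z
  lie_Y_Z : ⁅Y, Z⁆ = Complex.I • X
  lie_Z_X : ⁅Z, X⁆ = Complex.I • Y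

/-- Spin operators without common invariant subspaces other than `⊥` and `⊤`; unlike for
`IsSimpleModule`, the zero space is allowed. -/
structure IsIrreducibleSpinTriple (X Y Z : E →L[ℂ] E) : Prop extends IsSpinTriple X Y Z where
  eq_bot_or_eq_top : ∀ W : Submodule ℂ E, (∀ w ∈ W, X w ∈ W) → (∀ w ∈ W, Y w ∈ W) →
    (∀ w ∈ W, Z w ∈ W) → W = ⊥ ∨ W = ⊤

variable {X Y Z : E →L[ℂ] E}

lemma IsSpinTriple.rotate (h : IsSpinTriple X Y Z) : IsSpinTriple Z (-Y) X where
  isSelfAdjoint_X := h.isSelfAdjoint_Z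
  isSelfAdjoint_Y := h.isSelfAdjoint_Y.neg
  isSelfAdjoint_Z := h.isSelfAdjoint_X
  lie_X_Y := by rw [← h.lie_Y_Z, Ring.lie_def, Ring.lie_def]; noncomm_ring
  lie_Y_Z := by rw [← h.lie_X_Y, Ring.lie_def, Ring.lie_def]; noncomm_ring
  lie_Z_X := by rw [smul_neg, ← h.lie_Z_X, Ring.lie_def, Ring.lie_def]; noncomm_ring

lemma IsIrreducibleSpinTriple.rotate (h : IsIrreducibleSpinTriple X Y Z) :
    IsIrreducibleSpinTriple Z (-Y) X where
  toIsSpinTriple := h.toIsSpinTriple.rotate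
  eq_bot_or_eq_top W hZ hY hX :=
    h.eq_bot_or_eq_top W hX (fun w hw => by simpa using W.neg_mem (hY w hw)) hZ

end SpinTriple

section Differential

variable {E : Type*} [NormedAddCommGroup E] [InnerProductSpace ℂ E] [CompleteSpace E]

lemma inExpCoordinates_zero (ρ : SU2 →* unitary (E →L[ℂ] E)) : inExpCoordinates ρ 0 = 1 := by
  simp [inExpCoordinates, expSU2_zero]

lemma inExpCoordinates_add_smul (ρ : SU2 →* unitary (E →L[ℂ] E)) (s t : ℝ) (a : Fin 3 → ℝ) :
    inExpCoordinates ρ ((s + t) • a) =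
      inExpCoordinates ρ (s • a) * inExpCoordinates ρ (t • a) := by
  simp [inExpCoordinates, expSU2_add_smul]

lemma star_inExpCoordinates (ρ : SU2 →* unitary (E →L[ℂ] E)) (a : Fin 3 → ℝ) :
    star (inExpCoordinates ρ a) = inExpCoordinates ρ (-a) := by
  rw [inExpCoordinates, inExpCoordinates, expSU2_neg, map_inv, ← Unitary.star_eq_inv,
    Unitary.coe_star]

/-- The differential of a unitary representation at the identity, in exponential coordinates. -/
noncomputable def differential (ρ : SU2 →* unitary (E →L[ℂ] E)) : (Fin 3 → ℝ) →L[ℝ] (E →L[ℂ] E) :=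
  fderiv ℝ (inExpCoordinates ρ) 0

lemma J_eq (ρ : SU2 →* unitary (E →L[ℂ] E)) (k : Fin 3) :
    J ρ k = Complex.I • differential ρ (Pi.single k 1) := rfl

variable {ρ : SU2 →* unitary (E →L[ℂ] E)}

lemma hasDerivAt_inExpCoordinates_zero (h : IsDifferentiable ρ) (a : Fin 3 → ℝ) :
    HasDerivAt (fun t : ℝ => inExpCoordinates ρ (t • a)) (differential ρ a) 0 := by
  have h1 : HasDerivAt (fun t : ℝ => t • a) a 0 := by
    simpa using (hasDerivAt_id (0 : ℝ)).smul_const a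
  have h2 : HasFDerivAt (inExpCoordinates ρ) (differential ρ) ((0 : ℝ) • a) := by
    rw [zero_smul]; exact DifferentiableAt.hasFDerivAt h
  exact h2.comp_hasDerivAt (0 : ℝ) h1

lemma hasDerivAt_inExpCoordinates (h : IsDifferentiable ρ) (a : Fin 3 → ℝ) (t : ℝ) :
    HasDerivAt (fun t : ℝ => inExpCoordinates ρ (t • a))
      (inExpCoordinates ρ (t • a) * differential ρ a) t := by
  have h1 : HasDerivAt (fun s : ℝ => inExpCoordinates ρ (s • a)) (differential ρ a) (t - t) := by
    rw [sub_self]; exact hasDerivAt_inExpCoordinates_zero h a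
  have h2 := (h1.comp_sub_const t t).const_mul (inExpCoordinates ρ (t • a))
  simpa only [← inExpCoordinates_add_smul, add_sub_cancel] using h2

lemma inExpCoordinates_eq_exp (h : IsDifferentiable ρ) (a : Fin 3 → ℝ) :
    inExpCoordinates ρ a = NormedSpace.exp (differential ρ a) := by
  simpa using eq_exp_of_hasDerivAt (f := fun t : ℝ => inExpCoordinates ρ (t • a))
    (by simp [inExpCoordinates_zero]) (hasDerivAt_inExpCoordinates h a) 1

lemma star_differential (h : IsDifferentiable ρ) (a : Fin 3 → ℝ) :
    star (differential ρ a) = -differential ρ a := by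
  have h1 := (hasDerivAt_inExpCoordinates_zero h a).star
  have h2 := hasDerivAt_inExpCoordinates_zero h (-a)
  simp only [star_inExpCoordinates, smul_neg, map_neg] at h1 h2
  exact h1.unique h2

lemma conj_differential (h : IsDifferentiable ρ) (g : SU2) (a : Fin 3 → ℝ) :
    (ρ g : E →L[ℂ] E) * differential ρ a * (ρ g⁻¹ : E →L[ℂ] E) =
      differential ρ (adjointAction g a) := by
  have h1 := ((hasDerivAt_inExpCoordinates_zero h a).const_mul (ρ g : E →L[ℂ] E)).mul_const
    (ρ g⁻¹ : E →L[ℂ] E)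
  have h2 := hasDerivAt_inExpCoordinates_zero h (adjointAction g a)
  simp only [inExpCoordinates, ← adjointAction_smul, ← conj_expSU2, map_mul,
    Submonoid.coe_mul] at h1 h2
  exact h1.unique h2

attribute [local instance] Matrix.linftyOpNormedRing Matrix.linftyOpNormedAlgebra in
lemma hasDerivAt_differential_adjointAction (ρ : SU2 →* unitary (E →L[ℂ] E))
    (a b : Fin 3 → ℝ) :
    HasDerivAt (fun t : ℝ => differential ρ (adjointAction (expSU2 (t • a)) b))
      (differential ρ (su2Coord ⁅su2 a, su2 b⁆)) 0 := by
  have h := (LinearMap.toContinuousLinearMap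
    ((differential ρ).toLinearMap ∘ₗ su2Coord)).hasFDerivAt.comp_hasDerivAt (0 : ℝ)
    (hasDerivAt_exp_mul_exp_neg (su2 a) (su2 b))
  refine h.congr_of_eventuallyEq (Filter.Eventually.of_forall fun t => ?_)
  simp only [adjointAction, ← expSU2_neg]
  change differential ρ (su2Coord (NormedSpace.exp (su2 (t • a)) * su2 b *
    NormedSpace.exp (su2 (-(t • a))))) = _
  rw [su2_neg, su2_smul]
  rfl

lemma lie_differential (h : IsDifferentiable ρ) (a b : Fin 3 → ℝ) :
    ⁅differential ρ a, differential ρ b⁆ = differential ρ (su2Coord ⁅su2 a, su2 b⁆) := by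
  have h1 := ((hasDerivAt_inExpCoordinates_zero h a).mul_const (differential ρ b)).mul
    (hasDerivAt_inExpCoordinates_zero h (-a))
  have h2 := hasDerivAt_differential_adjointAction ρ a b
  simp only [← conj_differential h, ← expSU2_neg, ← smul_neg] at h2
  simpa [inExpCoordinates_zero, sub_eq_add_neg, Ring.lie_def] using h1.unique h2

end Differential

section Generators

variable {E : Type*} [NormedAddCommGroup E] [InnerProductSpace ℂ E] [CompleteSpace E]
  {ρ : SU2 →* unitary (E →L[ℂ] E)}

lemma pauli_zero : pauli 0 = !![0, 1; 1, 0] := rfl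

lemma pauli_one : pauli 1 = !![0, -Complex.I; Complex.I, 0] := rfl

lemma pauli_two : pauli 2 = !![1, 0; 0, -1] := rfl

lemma smul_lie_smul {A : Type*} [Ring A] [Algebra ℂ A] (c : ℂ) (X Y : A) :
    ⁅c • X, c • Y⁆ = (c * c) • ⁅X, Y⁆ := by
  simp only [Ring.lie_def, smul_mul_smul_comm, smul_sub]

lemma lie_pauli (k : Fin 3) :
    ⁅pauli k, pauli (k + 1)⁆ = (2 * Complex.I) • pauli (k + 2) := by
  fin_cases k
  · change ⁅pauli 0, pauli 1⁆ = (2 * Complex.I) • pauli 2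
    rw [pauli_zero, pauli_one, pauli_two, Ring.lie_def]
    ext i j
    fin_cases i <;> fin_cases j <;> norm_num [Complex.ext_iff]
  · change ⁅pauli 1, pauli 2⁆ = (2 * Complex.I) • pauli 0
    rw [pauli_zero, pauli_one, pauli_two, Ring.lie_def]
    ext i j
    fin_cases i <;> fin_cases j <;> norm_num [Complex.ext_iff]
  · change ⁅pauli 2, pauli 0⁆ = (2 * Complex.I) • pauli 1
    rw [pauli_zero, pauli_one, pauli_two, Ring.lie_def]
    ext i j
    fin_cases i <;> fin_cases j <;> norm_num [Complex.ext_iff]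

lemma lie_su2_single (k : Fin 3) :
    ⁅su2 (Pi.single k 1), su2 (Pi.single (k + 1) 1)⁆ = su2 (Pi.single (k + 2) 1) := by
  simp only [su2_single, smul_lie_smul, lie_pauli, smul_smul]
  congr 1
  linear_combination (Complex.I / 2) * Complex.I_sq

lemma lie_J (h : IsDifferentiable ρ) (k : Fin 3) :
    ⁅J ρ k, J ρ (k + 1)⁆ = Complex.I • J ρ (k + 2) := by
  simp only [J_eq, smul_lie_smul, lie_differential h, lie_su2_single, su2Coord_su2, smul_smul]

lemma isSelfAdjoint_J (h : IsDifferentiable ρ) (k : Fin 3) : IsSelfAdjoint (J ρ k) := by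
  simp [IsSelfAdjoint, J_eq, star_smul, star_differential h]

lemma isSpinTriple_J (h : IsDifferentiable ρ) : IsSpinTriple (J ρ 0) (J ρ 1) (J ρ 2) where
  isSelfAdjoint_X := isSelfAdjoint_J h 0
  isSelfAdjoint_Y := isSelfAdjoint_J h 1
  isSelfAdjoint_Z := isSelfAdjoint_J h 2
  lie_X_Y := lie_J h 0
  lie_Y_Z := lie_J h 1
  lie_Z_X := lie_J h 2

lemma differential_apply_mem {W : Submodule ℂ E} (hW : ∀ k, ∀ w ∈ W, J ρ k w ∈ W)
    (a : Fin 3 → ℝ) {w : E} (hw : w ∈ W) : differential ρ a w ∈ W := by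
  rw [pi_eq_sum_univ' a, map_sum, sum_apply]
  refine W.sum_mem fun k _ => ?_
  have hk : differential ρ (Pi.single k 1) w = -Complex.I • J ρ k w := by
    simp [J_eq, smul_smul]
  rw [map_smul, smul_apply, hk]
  exact W.smul_of_tower_mem (a k) (W.smul_mem _ (hW k w hw))

lemma eq_bot_or_eq_top_of_J_invariant [FiniteDimensional ℂ E] (h : IsDifferentiable ρ)
    (hirr : (toRepresentation ρ).IsIrreducible) (W : Submodule ℂ E)
    (hW : ∀ k, ∀ w ∈ W, J ρ k w ∈ W) : W = ⊥ ∨ W = ⊤ := by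
  let V : Subrepresentation (toRepresentation ρ) :=
    { toSubmodule := W
      apply_mem_toSubmodule := by
        intro g v hv
        obtain ⟨a, rfl⟩ := expSU2_surjective g
        change inExpCoordinates ρ a v ∈ W
        rw [inExpCoordinates_eq_exp h]
        exact exp_apply_mem W.closed_of_finiteDimensional
          (fun w hw => differential_apply_mem hW a hw) hv }
  exact (hirr.eq_bot_or_eq_top V).imp (congrArg Subrepresentation.toSubmodule)
    (congrArg Subrepresentation.toSubmodule)

lemma isIrreducibleSpinTriple_J [FiniteDimensional ℂ E] (h : IsDifferentiable ρ)
    (hirr : (toRepresentation ρ).IsIrreducible) :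
    IsIrreducibleSpinTriple (J ρ 0) (J ρ 1) (J ρ 2) where
  toIsSpinTriple := isSpinTriple_J h
  eq_bot_or_eq_top W h0 h1 h2 := eq_bot_or_eq_top_of_J_invariant h hirr W fun k => by
    fin_cases k
    exacts [h0, h1, h2]

end Generators

section Ladder

attribute [local instance] LieRing.ofAssociativeRing

lemma isSl2Triple_of_lie {L : Type*} [LieRing L] [LieAlgebra ℂ L] {X Y Z : L} (hZ : Z ≠ 0)
    (hXY : ⁅X, Y⁆ = Complex.I • Z) (hYZ : ⁅Y, Z⁆ = Complex.I • X)
    (hZX : ⁅Z, X⁆ = Complex.I • Y) :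
    IsSl2Triple ((-2 : ℂ) • Z) (X - Complex.I • Y) (X + Complex.I • Y) := by
  have hYX : ⁅Y, X⁆ = -(Complex.I • Z) := by rw [← hXY, lie_skew]
  have hZY : ⁅Z, Y⁆ = -(Complex.I • X) := by rw [← hYZ, lie_skew]
  constructor
  · exact smul_ne_zero (by norm_num) hZ
  · simp only [sub_lie, lie_add, smul_lie, lie_smul, lie_self, hXY, hYX]
    match_scalars
    linear_combination 2 * Complex.I_sq
  · simp only [lie_sub, smul_lie, lie_smul, hZX, hZY]
    match_scalars
    · ring
    · linear_combination -2 * Complex.I_sq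
  · simp only [lie_add, smul_lie, lie_smul, hZX, hZY]
    match_scalars
    · ring
    · linear_combination 2 * Complex.I_sq

/-- The off-diagonal entry of `J_x` between the weight vectors `k - 1` and `k` in dimension `n`. -/
noncomputable def ladderCoeff (n k : ℕ) : ℝ := √((k : ℝ) * (n - k)) / 2

/-- The `k`-th weight `k - (n - 1) / 2` in dimension `n`, counted from the lowest one. -/
noncomputable def weight (n k : ℕ) : ℝ := k - ((n : ℝ) - 1) / 2

lemma ladderCoeff_zero (n : ℕ) : ladderCoeff n 0 = 0 := by
  simp [ladderCoeff]

lemma ladderCoeff_eq_zero_of_le {n k : ℕ} (h : n ≤ k) : ladderCoeff n k = 0 := by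
  have h' : (n : ℝ) ≤ k := by exact_mod_cast h
  rw [ladderCoeff, Real.sqrt_eq_zero_of_nonpos, zero_div]
  exact mul_nonpos_of_nonneg_of_nonpos k.cast_nonneg (sub_nonpos.2 h')

lemma ladderCoeff_nonneg (n k : ℕ) : 0 ≤ ladderCoeff n k :=
  div_nonneg (Real.sqrt_nonneg _) zero_le_two

lemma two_mul_ladderCoeff_sq {n k : ℕ} (h : k ≤ n) :
    (2 * ladderCoeff n k) ^ 2 = k * (n - k) := by
  have h' : (k : ℝ) ≤ n := by exact_mod_cast h
  rw [ladderCoeff, mul_div_cancel₀ _ two_ne_zero,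
    Real.sq_sqrt (mul_nonneg k.cast_nonneg (sub_nonneg.2 h'))]

variable {E : Type*} [NormedAddCommGroup E] [InnerProductSpace ℂ E]

/-- The vectors `u k = (X + iY) ^ k u 0` generated by a vector `u 0` of lowest weight; there are
`n` nonzero ones. -/
structure IsLadder (n : ℕ) (X Y Z : E →L[ℂ] E) (u : ℕ → E) : Prop where
  ne_zero : ∀ k < n, u k ≠ 0
  zero_of_le : ∀ k, n ≤ k → u k = 0
  pos : 0 < n
  apply_Z : ∀ k, Z (u k) = (weight n k : ℂ) • u k
  raise : ∀ k, X (u k) + Complex.I • Y (u k) = u (k + 1)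
  lower : ∀ k, X (u k) - Complex.I • Y (u k) =
    (((2 * ladderCoeff n k) ^ 2 : ℝ) : ℂ) • u (k - 1)

/-- An orthonormal basis `e 0, …, e (n - 1)` of weight vectors for `X, Y, Z`. The sequence is
padded by zeros, so that the formulas for the ladder operators hold for all indices; at `k = 0`
the junk term `e (0 - 1)` has coefficient zero. -/
structure IsWeightBasis (n : ℕ) (X Y Z : E →L[ℂ] E) (e : ℕ → E) : Prop where
  orthonormal : Orthonormal ℂ (fun k : Fin n => e k)
  span_eq_top : Submodule.span ℂ (Set.range e) = ⊤
  zero_of_le : ∀ k, n ≤ k → e k = 0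
  apply_Z : ∀ k, Z (e k) = (weight n k : ℂ) • e k
  apply_X : ∀ k, X (e k) =
    (ladderCoeff n (k + 1) : ℂ) • e (k + 1) + (ladderCoeff n k : ℂ) • e (k - 1)
  apply_Y : ∀ k, Y (e k) = (-Complex.I) •
    ((ladderCoeff n (k + 1) : ℂ) • e (k + 1) - (ladderCoeff n k : ℂ) • e (k - 1))

variable {X Y Z : E →L[ℂ] E} {n : ℕ} {u : ℕ → E}

lemma eq_half_smul_raise_add_lower (v w : E) :
    v = (1 / 2 : ℂ) • ((v + Complex.I • w) + (v - Complex.I • w)) := by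
  module

lemma eq_neg_half_I_smul_raise_sub_lower (v w : E) :
    w = (-Complex.I / 2) • ((v + Complex.I • w) - (v - Complex.I • w)) := by
  match_scalars
  · linear_combination Complex.I_sq
  · ring

lemma inner_eq_zero_of_apply_eq_smul [CompleteSpace E] (hZ : IsSelfAdjoint Z) {v w : E} {a b : ℝ}
    (hv : Z v = (a : ℂ) • v) (hw : Z w = (b : ℂ) • w) (hab : a ≠ b) : inner ℂ v w = 0 := by
  have h : inner ℂ (Z v) w = inner ℂ v (Z w) := hZ.isSymmetric v w
  rw [hv, hw, inner_smul_left, inner_smul_right, Complex.conj_ofReal] at h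
  have h0 : ((a : ℂ) - b) * inner ℂ v w = 0 := by linear_combination h
  exact (mul_eq_zero.1 h0).resolve_left (sub_ne_zero.2 (by exact_mod_cast hab))

lemma IsSpinTriple.exists_isLadder [CompleteSpace E] [FiniteDimensional ℂ E]
    (h : IsSpinTriple X Y Z) (hZ : Z ≠ 0) : ∃ n u, IsLadder n X Y Z u := by
  have : Nontrivial E := by
    obtain ⟨v, hv⟩ := DFunLike.ne_iff.1 hZ
    exact ⟨Z v, 0, hv⟩
  let X' : Module.End ℂ E := X
  let Y' : Module.End ℂ E := Y
  let Z' : Module.End ℂ E := Z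
  have t : IsSl2Triple ((-2 : ℂ) • Z') (X' - Complex.I • Y') (X' + Complex.I • Y') :=
    isSl2Triple_of_lie (fun h0 => hZ (ContinuousLinearMap.coe_inj.1 h0))
      (congrArg ContinuousLinearMap.toLinearMap h.lie_X_Y)
      (congrArg ContinuousLinearMap.toLinearMap h.lie_Y_Z)
      (congrArg ContinuousLinearMap.toLinearMap h.lie_Z_X)
  obtain ⟨μ, v, -, P⟩ := IsSl2Triple.exists_hasPrimitiveVectorWith (R := ℂ) (M := E) t
  obtain ⟨m, hm⟩ := P.exists_nat
  refine ⟨m + 1, fun k => ((LieModule.toEnd ℂ (Module.End ℂ E) E (X' + Complex.I • Y')) ^ k) v,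
    fun k hk => P.pow_toEnd_f_ne_zero_of_eq_nat hm (by omega), fun k hk => ?_, m.succ_pos,
    fun k => ?_, P.lie_f_pow_toEnd_f, fun k => ?_⟩
  · exact Module.End.pow_map_zero_of_le hk (P.pow_toEnd_f_eq_zero_of_eq_nat hm)
  · have hk : (-2 : ℂ) • Z _ = _ := P.lie_h_pow_toEnd_f k
    rw [← inv_smul_smul₀ (by norm_num : (-2 : ℂ) ≠ 0) (Z _), hk, smul_smul, hm, weight]
    congr 1
    push_cast
    ring
  · rcases k with _ | k
    · exact P.lie_e.trans (by simp [ladderCoeff_zero])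
    rcases le_or_gt (k + 1) (m + 1) with hk | hk
    · refine (P.lie_e_pow_succ_toEnd_f k).trans ?_
      rw [hm, two_mul_ladderCoeff_sq hk]
      congr 1
      push_cast
      ring
    · have hzero : ((LieModule.toEnd ℂ (Module.End ℂ E) E (X' + Complex.I • Y')) ^ (k + 1)) v = 0 :=
        Module.End.pow_map_zero_of_le hk.le (P.pow_toEnd_f_eq_zero_of_eq_nat hm)
      rw [hzero, ladderCoeff_eq_zero_of_le hk.le]
      simp

lemma IsLadder.span_eq_top [CompleteSpace E] (hu : IsLadder n X Y Z u)
    (h : IsIrreducibleSpinTriple X Y Z) : Submodule.span ℂ (Set.range u) = ⊤ := by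
  set W := Submodule.span ℂ (Set.range u) with hW
  have mem (k : ℕ) : u k ∈ W := Submodule.subset_span ⟨k, rfl⟩
  have invariant {T : E →L[ℂ] E} (hT : ∀ k, T (u k) ∈ W) : ∀ w ∈ W, T w ∈ W := by
    suffices W ≤ W.comap (T : E →ₗ[ℂ] E) from this
    rw [hW, Submodule.span_le]
    rintro _ ⟨k, rfl⟩
    exact hT k
  have hraise (k : ℕ) : X (u k) + Complex.I • Y (u k) ∈ W := hu.raise k ▸ mem (k + 1)
  have hlower (k : ℕ) : X (u k) - Complex.I • Y (u k) ∈ W :=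
    hu.lower k ▸ W.smul_mem _ (mem (k - 1))
  refine (h.eq_bot_or_eq_top W (invariant fun k => ?_) (invariant fun k => ?_)
    (invariant fun k => ?_)).resolve_left fun hbot => ?_
  · rw [eq_half_smul_raise_add_lower (X (u k)) (Y (u k))]
    exact W.smul_mem _ (W.add_mem (hraise k) (hlower k))
  · rw [eq_neg_half_I_smul_raise_sub_lower (X (u k)) (Y (u k))]
    exact W.smul_mem _ (W.sub_mem (hraise k) (hlower k))
  · rw [hu.apply_Z]
    exact W.smul_mem _ (mem k)
  · exact hu.ne_zero 0 hu.pos ((Submodule.mem_bot ℂ).1 (hbot ▸ mem 0))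

lemma weight_injective (n : ℕ) : Function.Injective (weight n) := fun k l h => by
  simpa [weight] using h

lemma IsLadder.inner_eq_zero [CompleteSpace E] (hu : IsLadder n X Y Z u)
    (hZ : IsSelfAdjoint Z) {k l : ℕ} (hkl : k ≠ l) : inner ℂ (u k) (u l) = 0 :=
  inner_eq_zero_of_apply_eq_smul hZ (hu.apply_Z k) (hu.apply_Z l) ((weight_injective n).ne hkl)

lemma IsLadder.finrank_eq [CompleteSpace E] (hu : IsLadder n X Y Z u)
    (h : IsIrreducibleSpinTriple X Y Z) : Module.finrank ℂ E = n := by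
  have hli : LinearIndependent ℂ (fun k : Fin n => u k) :=
    linearIndependent_of_ne_zero_of_inner_eq_zero (fun k => hu.ne_zero k k.2)
      fun k l hkl => hu.inner_eq_zero h.isSelfAdjoint_Z (Fin.val_injective.ne hkl)
  have hspan : Submodule.span ℂ (Set.range fun k : Fin n => u k) = ⊤ := by
    rw [eq_top_iff, ← hu.span_eq_top h, Submodule.span_le]
    rintro _ ⟨k, rfl⟩
    rcases lt_or_ge k n with hk | hk
    · exact Submodule.subset_span ⟨⟨k, hk⟩, rfl⟩
    · rw [hu.zero_of_le k hk]
      exact Submodule.zero_mem _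
  rw [← finrank_top, ← hspan, finrank_span_eq_card hli, Fintype.card_fin]

lemma IsLadder.norm_succ [CompleteSpace E] (hu : IsLadder n X Y Z u) (h : IsSpinTriple X Y Z)
    (k : ℕ) : ‖u (k + 1)‖ = 2 * ladderCoeff n (k + 1) * ‖u k‖ := by
  have adjoint (v w : E) : inner ℂ (X v + Complex.I • Y v) w =
      inner ℂ v (X w - Complex.I • Y w) := by
    have hX : inner ℂ (X v) w = inner ℂ v (X w) := h.isSelfAdjoint_X.isSymmetric v w
    have hY : inner ℂ (Y v) w = inner ℂ v (Y w) := h.isSelfAdjoint_Y.isSymmetric v w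
    rw [inner_add_left, inner_sub_right, inner_smul_left, inner_smul_right, hX, hY,
      Complex.conj_I, neg_mul, sub_eq_add_neg]
  have hinner : inner ℂ (u (k + 1)) (u (k + 1)) =
      (((2 * ladderCoeff n (k + 1)) ^ 2 : ℝ) : ℂ) * inner ℂ (u k) (u k) := by
    nth_rw 1 [← hu.raise k]
    rw [adjoint, hu.lower, inner_smul_right, Nat.add_sub_cancel]
  rw [← sq_eq_sq₀ (norm_nonneg _) (mul_nonneg (mul_nonneg zero_le_two (ladderCoeff_nonneg _ _))
    (norm_nonneg _)), mul_pow]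
  simp only [inner_self_eq_norm_sq_to_K, Complex.coe_algebraMap] at hinner
  exact_mod_cast hinner

lemma IsLadder.raise_inv_norm_smul [CompleteSpace E] (hu : IsLadder n X Y Z u)
    (h : IsSpinTriple X Y Z) (k : ℕ) :
    X (((‖u k‖⁻¹ : ℝ) : ℂ) • u k) + Complex.I • Y (((‖u k‖⁻¹ : ℝ) : ℂ) • u k) =
      ((2 * ladderCoeff n (k + 1) : ℝ) : ℂ) • ((‖u (k + 1)‖⁻¹ : ℝ) : ℂ) • u (k + 1) := by
  rw [map_smul, map_smul, smul_comm Complex.I, ← smul_add, hu.raise, smul_smul,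
    ← Complex.ofReal_mul, hu.norm_succ h k, mul_inv, ← mul_assoc]
  rcases eq_or_ne (2 * ladderCoeff n (k + 1)) 0 with h0 | h0
  · have : u (k + 1) = 0 := by rw [← norm_eq_zero, hu.norm_succ h, h0, zero_mul]
    rw [this, smul_zero, smul_zero]
  · rw [mul_inv_cancel₀ h0, one_mul]

lemma IsLadder.lower_inv_norm_smul [CompleteSpace E] (hu : IsLadder n X Y Z u)
    (h : IsSpinTriple X Y Z) (k : ℕ) :
    X (((‖u k‖⁻¹ : ℝ) : ℂ) • u k) - Complex.I • Y (((‖u k‖⁻¹ : ℝ) : ℂ) • u k) =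
      ((2 * ladderCoeff n k : ℝ) : ℂ) • ((‖u (k - 1)‖⁻¹ : ℝ) : ℂ) • u (k - 1) := by
  rw [map_smul, map_smul, smul_comm Complex.I, ← smul_sub, hu.lower, smul_smul, smul_smul,
    ← Complex.ofReal_mul, ← Complex.ofReal_mul]
  rcases k with _ | k
  · simp [ladderCoeff_zero]
  · rw [Nat.add_sub_cancel, hu.norm_succ h, mul_inv, mul_right_comm, sq, ← mul_assoc,
      inv_mul_mul_self]

lemma IsLadder.isWeightBasis [CompleteSpace E] (hu : IsLadder n X Y Z u)
    (h : IsIrreducibleSpinTriple X Y Z) :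
    IsWeightBasis n X Y Z fun k => ((‖u k‖⁻¹ : ℝ) : ℂ) • u k := by
  have raise := hu.raise_inv_norm_smul h.toIsSpinTriple
  have lower := hu.lower_inv_norm_smul h.toIsSpinTriple
  set e : ℕ → E := fun k => ((‖u k‖⁻¹ : ℝ) : ℂ) • u k with he
  refine ⟨⟨fun k => ?_, fun k l hkl => ?_⟩, ?_, fun k hk => ?_, fun k => ?_, fun k => ?_,
    fun k => ?_⟩
  · simp [he, norm_smul, hu.ne_zero k k.2]
  · simp [he, inner_smul_left, inner_smul_right,
      hu.inner_eq_zero h.isSelfAdjoint_Z (Fin.val_injective.ne hkl)]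
  · rw [eq_top_iff, ← hu.span_eq_top h, Submodule.span_le]
    rintro _ ⟨k, rfl⟩
    have : u k = (‖u k‖ : ℂ) • e k := by
      rcases eq_or_ne (u k) 0 with h0 | h0 <;> simp [he, h0, smul_smul]
    rw [this]
    exact Submodule.smul_mem _ _ (Submodule.subset_span ⟨k, rfl⟩)
  · simp [he, hu.zero_of_le k hk]
  · simp only [he, map_smul, hu.apply_Z, smul_comm (weight n k : ℂ)]
  · rw [eq_half_smul_raise_add_lower (X (e k)) (Y (e k)), raise, lower]
    push_cast
    module
  · rw [eq_neg_half_I_smul_raise_sub_lower (X (e k)) (Y (e k)), raise, lower]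
    push_cast
    module

lemma IsIrreducibleSpinTriple.ne_zero [CompleteSpace E] (h : IsIrreducibleSpinTriple X Y Z)
    (hE : 1 < Module.finrank ℂ E) : Z ≠ 0 := by
  rintro rfl
  have hX : X = 0 := by
    have := h.lie_Y_Z
    rw [Ring.lie_def, mul_zero, zero_mul, sub_zero, eq_comm, smul_eq_zero] at this
    exact this.resolve_left Complex.I_ne_zero
  have hY : Y = 0 := by
    have := h.lie_Z_X
    rw [Ring.lie_def, mul_zero, zero_mul, sub_zero, eq_comm, smul_eq_zero] at this
    exact this.resolve_left Complex.I_ne_zero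
  subst hX hY
  have : Nontrivial E := Module.nontrivial_of_finrank_pos (R := ℂ) (zero_lt_one.trans hE)
  obtain ⟨v, hv⟩ := exists_ne (0 : E)
  rcases h.eq_bot_or_eq_top (ℂ ∙ v) (by simp) (by simp) (by simp) with hbot | htop
  · exact hv (Submodule.span_singleton_eq_bot.1 hbot)
  · rw [← finrank_top, ← htop, finrank_span_singleton hv] at hE
    exact hE.false

lemma IsIrreducibleSpinTriple.exists_isWeightBasis [CompleteSpace E] [FiniteDimensional ℂ E]
    (h : IsIrreducibleSpinTriple X Y Z) (hE : 1 < Module.finrank ℂ E) :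
    ∃ e, IsWeightBasis (Module.finrank ℂ E) X Y Z e := by
  obtain ⟨n, u, hu⟩ := h.toIsSpinTriple.exists_isLadder (h.ne_zero hE)
  exact ⟨_, hu.finrank_eq h ▸ hu.isWeightBasis h⟩

end Ladder

section CentralBinomial

/-- The normalized central binomial coefficient `binom(2k, k) / 4^k`, the modulus squared of the
overlaps of weight vectors for orthogonal axes. -/
noncomputable def centralRatio (k : ℕ) : ℝ := (Nat.centralBinom k : ℝ) / 4 ^ k

lemma centralRatio_pos (k : ℕ) : 0 < centralRatio k :=
  div_pos (Nat.cast_pos.2 k.centralBinom_pos) (by positivity)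

lemma centralRatio_zero : centralRatio 0 = 1 := by simp [centralRatio]

lemma centralRatio_succ (k : ℕ) :
    (2 * k + 2) * centralRatio (k + 1) = (2 * k + 1) * centralRatio k := by
  have h : ((k : ℝ) + 1) * Nat.centralBinom (k + 1) = 2 * (2 * k + 1) * Nat.centralBinom k := by
    exact_mod_cast Nat.succ_mul_centralBinom_succ k
  rw [centralRatio, centralRatio, pow_succ]
  field_simp
  linear_combination 2 * h

lemma wallis_mul_centralRatio_sq (k : ℕ) :
    Real.Wallis.W k * ((2 * k + 1) * centralRatio k ^ 2) = 1 := by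
  induction k with
  | zero => simp [Real.Wallis.W, centralRatio_zero]
  | succ k ih =>
    have h : centralRatio k = (2 * k + 2) * centralRatio (k + 1) / (2 * k + 1) := by
      rw [centralRatio_succ]
      field_simp
    rw [h] at ih
    rw [Real.Wallis.W_succ]
    refine Eq.trans ?_ ih
    push_cast
    field_simp
    ring

lemma le_centralRatio_sq (k : ℕ) : 2 / (Real.pi * (2 * k + 1)) ≤ centralRatio k ^ 2 := by
  have hW : Real.Wallis.W k * ((2 * k + 1) * centralRatio k ^ 2) ≤
      Real.pi / 2 * ((2 * k + 1) * centralRatio k ^ 2) := by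
    gcongr
    exact Real.Wallis.W_le k
  rw [wallis_mul_centralRatio_sq] at hW
  rw [div_le_iff₀ (by positivity)]
  linarith

lemma le_centralRatio_mul (i k : ℕ) :
    2 / (Real.pi * (i + k + 1)) ≤ centralRatio i * centralRatio k := by
  have hpos := mul_pos (centralRatio_pos i) (centralRatio_pos k)
  refine le_of_sq_le_sq ?_ hpos.le
  calc (2 / (Real.pi * (i + k + 1))) ^ 2
      ≤ 2 / (Real.pi * (2 * i + 1)) * (2 / (Real.pi * (2 * k + 1))) := by
        rw [div_pow, div_mul_div_comm, div_le_div_iff₀ (by positivity) (by positivity)]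
        have : 0 ≤ Real.pi ^ 2 * ((i : ℝ) - k) ^ 2 := by positivity
        nlinarith
    _ ≤ centralRatio i ^ 2 * centralRatio k ^ 2 :=
        mul_le_mul (le_centralRatio_sq i) (le_centralRatio_sq k) (by positivity) (by positivity)
    _ = (centralRatio i * centralRatio k) ^ 2 := (mul_pow _ _ _).symm

lemma le_centralRatio_mul_sub {i m : ℕ} (h : i ≤ m) :
    2 / (Real.pi * (m + 1)) ≤ centralRatio i * centralRatio (m - i) := by
  have := le_centralRatio_mul i (m - i)
  rwa [Nat.cast_sub h, add_sub_cancel] at this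

end CentralBinomial

section Overlap

lemma weight_add (n k l : ℕ) : weight n k + weight n l = k + l - (n - 1) := by
  rw [weight, weight]
  ring

lemma weight_sub (n k l : ℕ) : weight n k - weight n l = k - l := by
  rw [weight, weight]
  ring

lemma ladderCoeff_pos {n k : ℕ} (h0 : 0 < k) (hk : k < n) : 0 < ladderCoeff n k :=
  div_pos (Real.sqrt_pos.2
    (mul_pos (Nat.cast_pos.2 h0) (sub_pos.2 (Nat.cast_lt.2 hk)))) two_pos

lemma ladderCoeff_ne_zero {n k : ℕ} (h0 : 0 < k) (hk : k < n) : (ladderCoeff n k : ℂ) ≠ 0 :=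
  Complex.ofReal_ne_zero.2 (ladderCoeff_pos h0 hk).ne'

lemma norm_sq_of_two_mul_ladderCoeff_mul_eq {n k : ℕ} (hk : k ≤ n) {x y : ℂ} {r : ℝ}
    (h : 2 * (ladderCoeff n k : ℂ) * x = r * y) :
    k * (n - k) * ‖x‖ ^ 2 = r ^ 2 * ‖y‖ ^ 2 := by
  have hnorm : ‖((2 * ladderCoeff n k : ℝ) : ℂ) * x‖ ^ 2 = ‖(r : ℂ) * y‖ ^ 2 := by
    rw [← h]
    push_cast
    rfl
  simp only [norm_mul, mul_pow, Complex.norm_real, Real.norm_eq_abs, sq_abs] at hnorm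
  rw [← two_mul_ladderCoeff_sq hk, mul_pow]
  exact hnorm

lemma norm_sq_eq_choose {n : ℕ} {x : ℕ → ℂ}
    (h : ∀ l, 2 * (ladderCoeff n (l + 1) : ℂ) * x (l + 1) = ((l - (n - 1) : ℝ) : ℂ) * x l)
    {l : ℕ} (hl : l < n) : ‖x l‖ ^ 2 = (n - 1).choose l * ‖x 0‖ ^ 2 := by
  induction l with
  | zero => simp
  | succ l ih =>
    have hx := norm_sq_of_two_mul_ladderCoeff_mul_eq hl.le (h l)
    have hchoose : (((n - 1).choose (l + 1) * (l + 1) : ℕ) : ℝ) =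
        ((n - 1).choose l * (n - 1 - l) : ℕ) :=
      congrArg _ (Nat.choose_succ_right_eq (n - 1) l)
    rw [ih (by omega)] at hx
    obtain ⟨d, rfl⟩ : ∃ d, n = l + 2 + d := ⟨n - (l + 2), by omega⟩
    rw [show l + 2 + d - 1 = l + 1 + d by omega] at hx hchoose ⊢
    rw [show l + 1 + d - l = d + 1 by omega] at hchoose
    push_cast at hx hchoose ⊢
    have hd : ((l : ℝ) + 1) * (d + 1) ≠ 0 := by positivity
    apply mul_left_cancel₀ hd
    linear_combination hx - (d + 1) * ‖x 0‖ ^ 2 * hchoose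

/-- The relations satisfied by the overlaps `M k l = ⟨e k, f l⟩` of a weight basis `e` for
`X, Y, Z` and a weight basis `f` for the rotated triple `Z, -Y, X`: they are the matrix elements
`⟨e k, A (f l)⟩` for `A = X, Z, Y`, computed on both sides. -/
structure IsOverlap (n : ℕ) (M : ℕ → ℕ → ℂ) : Prop where
  left : ∀ k l, (weight n l : ℂ) * M k l =
    ladderCoeff n (k + 1) * M (k + 1) l + ladderCoeff n k * M (k - 1) l
  right : ∀ k l, (weight n k : ℂ) * M k l =
    ladderCoeff n (l + 1) * M k (l + 1) + ladderCoeff n l * M k (l - 1)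
  mixed : ∀ k l, (ladderCoeff n (k + 1) : ℂ) * M (k + 1) l - ladderCoeff n k * M (k - 1) l =
    ladderCoeff n (l + 1) * M k (l + 1) - ladderCoeff n l * M k (l - 1)
  sum_norm_sq : ∑ k ∈ Finset.range n, ‖M k 0‖ ^ 2 = 1

namespace IsOverlap

variable {n : ℕ} {M : ℕ → ℕ → ℂ}

lemma right_succ (hM : IsOverlap n M) (k l : ℕ) : 2 * (ladderCoeff n (l + 1) : ℂ) * M k (l + 1) =
    ((weight n k + weight n l : ℝ) : ℂ) * M k l - 2 * ladderCoeff n k * M (k - 1) l := by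
  push_cast
  linear_combination -hM.left k l - hM.right k l - hM.mixed k l

lemma left_succ (hM : IsOverlap n M) (k l : ℕ) : 2 * (ladderCoeff n (k + 1) : ℂ) * M (k + 1) l =
    ((weight n k + weight n l : ℝ) : ℂ) * M k l - 2 * ladderCoeff n l * M k (l - 1) := by
  push_cast
  linear_combination -hM.left k l - hM.right k l + hM.mixed k l

lemma left_succ' (hM : IsOverlap n M) (k l : ℕ) : 2 * (ladderCoeff n (k + 1) : ℂ) * M (k + 1) l =
    ((weight n l - weight n k : ℝ) : ℂ) * M k l + 2 * ladderCoeff n (l + 1) * M k (l + 1) := by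
  push_cast
  linear_combination -hM.left k l + hM.right k l + hM.mixed k l

lemma norm_sq_zero_row (hM : IsOverlap n M) {l : ℕ} (hl : l < n) :
    ‖M 0 l‖ ^ 2 = (n - 1).choose l / 2 ^ (n - 1) := by
  have hrow : ‖M 0 l‖ ^ 2 = (n - 1).choose l * ‖M 0 0‖ ^ 2 := by
    refine norm_sq_eq_choose (x := fun l => M 0 l) (fun l => ?_) hl
    rw [hM.right_succ 0 l, ladderCoeff_zero, weight_add]
    push_cast
    ring
  have hcol {k : ℕ} (hk : k < n) : ‖M k 0‖ ^ 2 = (n - 1).choose k * ‖M 0 0‖ ^ 2 := by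
    refine norm_sq_eq_choose (x := fun k => M k 0) (fun k => ?_) hk
    rw [hM.left_succ k 0, ladderCoeff_zero, weight_add]
    push_cast
    ring
  have hchoose : ∑ k ∈ Finset.range n, (n - 1).choose k = 2 ^ (n - 1) := by
    conv_lhs => rw [show n = n - 1 + 1 by omega]
    exact Nat.sum_range_choose (n - 1)
  have hsum := hM.sum_norm_sq
  rw [Finset.sum_congr rfl fun k hk => hcol (Finset.mem_range.1 hk), ← Finset.sum_mul,
    ← Nat.cast_sum, hchoose] at hsum
  push_cast at hsum
  rw [hrow, eq_div_iff (by positivity)]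
  linear_combination ((n - 1).choose l : ℝ) * hsum

section OddDimension

variable {j : ℕ}

lemma ladderCoeff_mul_middle_column (hM : IsOverlap (2 * j + 1) M) (k : ℕ) :
    (ladderCoeff (2 * j + 1) (k + 1) : ℂ) * M (k + 1) j =
      -(ladderCoeff (2 * j + 1) k * M (k - 1) j) := by
  have hw : weight (2 * j + 1) j = 0 := by
    rw [weight]
    push_cast
    ring
  have h := hM.left k j
  rw [hw, Complex.ofReal_zero] at h
  linear_combination -h

lemma middle_column_odd (hM : IsOverlap (2 * j + 1) M) {i : ℕ} (hi : i < j) :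
    M (2 * i + 1) j = 0 := by
  induction i with
  | zero =>
    have h := hM.ladderCoeff_mul_middle_column 0
    rw [ladderCoeff_zero, Complex.ofReal_zero, zero_mul, neg_zero] at h
    exact (mul_eq_zero.1 h).resolve_left (ladderCoeff_ne_zero (by omega) (by omega))
  | succ i ih =>
    have h := hM.ladderCoeff_mul_middle_column (2 * i + 2)
    rw [show 2 * i + 2 - 1 = 2 * i + 1 by omega, ih (by omega), mul_zero, neg_zero] at h
    exact (mul_eq_zero.1 h).resolve_left (ladderCoeff_ne_zero (by omega) (by omega))

lemma norm_sq_middle_column_even (hM : IsOverlap (2 * j + 1) M) {i : ℕ} (hi : i ≤ j) :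
    ‖M (2 * i) j‖ ^ 2 = centralRatio i * centralRatio (j - i) := by
  induction i with
  | zero =>
    rw [mul_zero, hM.norm_sq_zero_row (by omega), centralRatio_zero, one_mul, Nat.sub_zero,
      centralRatio, Nat.centralBinom, Nat.add_sub_cancel, pow_mul]
    norm_num
  | succ i ih =>
    have h := norm_sq_of_two_mul_ladderCoeff_mul_eq (n := 2 * j + 1) (k := 2 * i + 2)
      (x := M (2 * i + 2) j) (y := M (2 * i) j) (r := -(2 * ladderCoeff (2 * j + 1) (2 * i + 1)))
      (by omega) (by
        have := hM.ladderCoeff_mul_middle_column (2 * i + 1)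
        rw [Nat.add_sub_cancel] at this
        push_cast
        linear_combination 2 * this)
    rw [neg_sq, two_mul_ladderCoeff_sq (by omega), ih (by omega)] at h
    obtain ⟨d, rfl⟩ : ∃ d, j = i + 1 + d := ⟨j - (i + 1), by omega⟩
    rw [show i + 1 + d - i = d + 1 by omega] at h
    rw [show i + 1 + d - (i + 1) = d by omega, show 2 * (i + 1) = 2 * i + 2 by ring]
    push_cast at h
    have hd : (2 * (i : ℝ) + 2) * (2 * d + 1) ≠ 0 := by positivity
    apply mul_left_cancel₀ hd
    linear_combination h + (2 * i + 1) * centralRatio i * centralRatio_succ d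
      - (2 * d + 1) * centralRatio d * centralRatio_succ i

end OddDimension

section EvenDimension

variable {m : ℕ}

lemma two_mul_ladderCoeff_half (m : ℕ) : 2 * (ladderCoeff (2 * m) m : ℂ) = m := by
  have h : 2 * ladderCoeff (2 * m) m = m := by
    rw [ladderCoeff, mul_div_cancel₀ _ two_ne_zero]
    push_cast
    rw [show (m : ℝ) * (2 * m - m) = m ^ 2 by ring, Real.sqrt_sq m.cast_nonneg]
  exact_mod_cast congrArg Complex.ofReal h

lemma middle_columns (hM : IsOverlap (2 * m) M) {k : ℕ} (hk : k < 2 * m) :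
    M k (m - 1) = -(-1) ^ k * M k m := by
  have hm : m - 1 + 1 = m := by omega
  have hcast : ((m - 1 : ℕ) : ℝ) = m - 1 := by rw [Nat.cast_sub (by omega), Nat.cast_one]
  induction k with
  | zero =>
    have h := hM.right_succ 0 (m - 1)
    rw [hm, two_mul_ladderCoeff_half, ladderCoeff_zero, weight_add, hcast] at h
    push_cast at h
    have hm0 : (m : ℂ) ≠ 0 := Nat.cast_ne_zero.2 (by omega)
    apply mul_left_cancel₀ hm0
    linear_combination h
  | succ k ih =>
    have h := hM.left_succ k m
    have h' := hM.left_succ' k (m - 1)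
    rw [weight_add, two_mul_ladderCoeff_half, ih (by omega)] at h
    rw [weight_sub, hm, two_mul_ladderCoeff_half, hcast, ih (by omega)] at h'
    apply mul_left_cancel₀ (mul_ne_zero (two_ne_zero' ℂ) (ladderCoeff_ne_zero k.succ_pos hk))
    have hs : ((-1 : ℂ) ^ k) * (-1) ^ k = 1 := by rw [← mul_pow]; simp
    push_cast at h h'
    rw [pow_succ]
    linear_combination h' - (-1) ^ k * h - (m : ℂ) * M k m * hs

lemma norm_sq_middle_column_succ (hM : IsOverlap (2 * m) M) {k : ℕ} (hk : k < 2 * m) :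
    (k + 1) * (2 * m - (k + 1)) * ‖M (k + 1) m‖ ^ 2 =
      (k + 1 - m + (-1) ^ k * m) ^ 2 * ‖M k m‖ ^ 2 := by
  have h : 2 * (ladderCoeff (2 * m) (k + 1) : ℂ) * M (k + 1) m =
      ((k + 1 - m + (-1) ^ k * m : ℝ) : ℂ) * M k m := by
    rw [hM.left_succ k m, two_mul_ladderCoeff_half, hM.middle_columns hk, weight_add]
    push_cast
    ring
  exact_mod_cast norm_sq_of_two_mul_ladderCoeff_mul_eq hk h

lemma norm_sq_middle_column_zero (hM : IsOverlap (2 * m) M) (hm : 0 < m) :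
    ‖M 0 m‖ ^ 2 = centralRatio m := by
  obtain ⟨d, rfl⟩ : ∃ d, m = d + 1 := ⟨m - 1, by omega⟩
  have hcentral : (Nat.centralBinom (d + 1) : ℝ) = 2 * (2 * d + 1).choose (d + 1) := by
    rw [Nat.centralBinom, show 2 * (d + 1) = 2 * d + 1 + 1 by ring, Nat.choose_succ_succ,
      Nat.choose_symm_of_eq_add (show 2 * d + 1 = d + (d + 1) by ring)]
    push_cast
    ring
  have hpow : (4 : ℝ) ^ (d + 1) = 2 * 2 ^ (2 * d + 1) := by
    rw [show (4 : ℝ) = 2 ^ 2 by norm_num, ← pow_mul]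
    ring
  rw [hM.norm_sq_zero_row (by omega), centralRatio, hcentral, hpow,
    mul_div_mul_left _ _ two_ne_zero]
  rfl

lemma norm_sq_middle_column_odd_of_even (hM : IsOverlap (2 * m) M) {i : ℕ} (hi : i < m)
    (h : m * ‖M (2 * i) m‖ ^ 2 = centralRatio i * centralRatio (m - i) * (m - i)) :
    m * ‖M (2 * i + 1) m‖ ^ 2 = centralRatio (i + 1) * centralRatio (m - (i + 1)) * (i + 1) := by
  have hstep := hM.norm_sq_middle_column_succ (k := 2 * i) (by omega)
  obtain ⟨d, rfl⟩ : ∃ d, m = i + 1 + d := ⟨m - (i + 1), by omega⟩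
  rw [show i + 1 + d - i = d + 1 by omega] at h
  rw [show i + 1 + d - (i + 1) = d by omega]
  rw [pow_mul, neg_one_sq, one_pow] at hstep
  push_cast at h hstep ⊢
  have hd : (2 * (i : ℝ) + 1) * (2 * d + 1) ≠ 0 := by positivity
  apply mul_left_cancel₀ hd
  linear_combination (i + 1 + d : ℝ) * hstep + (2 * i + 1) ^ 2 * h
    + (2 * i + 1) ^ 2 / 2 * centralRatio i * centralRatio_succ d
    - (2 * i + 1) * (2 * d + 1) / 2 * centralRatio d * centralRatio_succ i

lemma norm_sq_middle_column_two_mul (hM : IsOverlap (2 * m) M) {i : ℕ} (hi : i < m) :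
    m * ‖M (2 * i) m‖ ^ 2 = centralRatio i * centralRatio (m - i) * (m - i) := by
  induction i with
  | zero =>
    rw [mul_zero, hM.norm_sq_middle_column_zero hi, centralRatio_zero, Nat.sub_zero, Nat.cast_zero]
    ring
  | succ i ih =>
    have hodd := hM.norm_sq_middle_column_odd_of_even (by omega) (ih (by omega))
    have hstep := hM.norm_sq_middle_column_succ (k := 2 * i + 1) (by omega)
    obtain ⟨d, rfl⟩ : ∃ d, m = i + 2 + d := ⟨m - (i + 2), by omega⟩
    rw [show i + 2 + d - (i + 1) = d + 1 by omega] at hodd ⊢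
    rw [Odd.neg_one_pow ⟨i, rfl⟩] at hstep
    rw [show 2 * (i + 1) = 2 * i + 1 + 1 by ring]
    push_cast at hodd hstep ⊢
    have hd : (4 : ℝ) * ((i : ℝ) + 1) * (d + 1) ≠ 0 := by positivity
    apply mul_left_cancel₀ hd
    linear_combination (i + 2 + d : ℝ) * hstep + 4 * (d + 1) ^ 2 * hodd

lemma norm_sq_middle_column_two_mul_add_one (hM : IsOverlap (2 * m) M) {i : ℕ} (hi : i < m) :
    m * ‖M (2 * i + 1) m‖ ^ 2 = centralRatio (i + 1) * centralRatio (m - (i + 1)) * (i + 1) :=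
  hM.norm_sq_middle_column_odd_of_even hi (hM.norm_sq_middle_column_two_mul hi)

end EvenDimension

end IsOverlap

end Overlap

section Factorization

/-- The right-hand side of the Christoffel–Darboux formula `sub_mul_inner_positiveProjection` for
the sum of `M k l * conj (M k' l)` over the `l ≥ (n + 1) / 2`, which are those with
`weight n l > 0`. -/
noncomputable def middleMinor (n : ℕ) (M : ℕ → ℕ → ℂ) (k k' : ℕ) : ℂ :=
  ladderCoeff n ((n + 1) / 2) * (M k ((n + 1) / 2 - 1) * conj (M k' ((n + 1) / 2)) -
    M k ((n + 1) / 2) * conj (M k' ((n + 1) / 2 - 1)))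

lemma le_mul_of_le_sq_of_le_sq {d x y : ℝ} (hx : 0 ≤ x) (hy : 0 ≤ y) (hdx : d ≤ x ^ 2)
    (hdy : d ≤ y ^ 2) : d ≤ x * y := by
  rcases le_total x y with h | h
  · exact hdx.trans (by rw [sq]; gcongr)
  · exact hdy.trans (by rw [sq]; gcongr)

namespace IsOverlap

variable {m : ℕ} {M : ℕ → ℕ → ℂ} {B : ℝ}

lemma middleMinor_of_even_dim (hM : IsOverlap (2 * m) M) {k k' : ℕ} (hk : Odd k) (hk' : Even k')
    (hkm : k < 2 * m) (hkm' : k' < 2 * m) :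
    middleMinor (2 * m) M k k' = m * M k m * conj (M k' m) := by
  rw [middleMinor, show (2 * m + 1) / 2 = m by omega, hM.middle_columns hkm,
    hM.middle_columns hkm', hk.neg_one_pow, hk'.neg_one_pow]
  simp only [map_mul, map_neg, map_one]
  linear_combination M k m * conj (M k' m) * two_mul_ladderCoeff_half m

lemma middleMinor_of_odd_dim (hM : IsOverlap (2 * m + 1) M) {k : ℕ} (hk : Odd k)
    (hkm : k < 2 * m + 1) (k' : ℕ) :
    middleMinor (2 * m + 1) M k k' =
      ladderCoeff (2 * m + 1) k * M (k - 1) m * conj (M k' m) := by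
  obtain ⟨i, rfl⟩ := hk
  have hright := hM.right_succ (2 * i + 1) m
  rw [middleMinor, show (2 * m + 1 + 1) / 2 = m + 1 by omega, Nat.add_sub_cancel]
  rw [hM.middle_column_odd (by omega)] at hright ⊢
  linear_combination -(1 / 2) * conj (M k' m) * hright

lemma le_norm_sq_middle_column_two_mul (hM : IsOverlap (2 * m) M) {i : ℕ} (hi : i < m)
    (hB : B ≤ 2 * m - 2 * i) : B / (Real.pi * (m + 1)) ≤ m * ‖M (2 * i) m‖ ^ 2 := by
  have him : (i : ℝ) < m := Nat.cast_lt.2 hi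
  calc B / (Real.pi * (m + 1)) = 2 / (Real.pi * (m + 1)) * (B / 2) := by ring
    _ ≤ 2 / (Real.pi * (m + 1)) * (m - i) := by gcongr; linarith
    _ ≤ centralRatio i * centralRatio (m - i) * (m - i) :=
      mul_le_mul_of_nonneg_right (le_centralRatio_mul_sub hi.le) (by linarith)
    _ = _ := (hM.norm_sq_middle_column_two_mul hi).symm

lemma le_norm_sq_middle_column_two_mul_add_one (hM : IsOverlap (2 * m) M) {i : ℕ} (hi : i < m)
    (hB : B ≤ 2 * i + 1) : B / (Real.pi * (m + 1)) ≤ m * ‖M (2 * i + 1) m‖ ^ 2 := by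
  calc B / (Real.pi * (m + 1)) = 2 / (Real.pi * (m + 1)) * (B / 2) := by ring
    _ ≤ 2 / (Real.pi * (m + 1)) * (i + 1) := by gcongr; linarith
    _ ≤ centralRatio (i + 1) * centralRatio (m - (i + 1)) * (i + 1) := by
      gcongr
      exact le_centralRatio_mul_sub hi
    _ = _ := (hM.norm_sq_middle_column_two_mul_add_one hi).symm

lemma le_norm_mul_norm_of_even_dim (hM : IsOverlap (2 * m) M) {k k' : ℕ} (hk : Odd k)
    (hk' : Even k') (hkm : k < 2 * m) (hkm' : k' < 2 * m) (hBk : B ≤ k) (hBk' : B ≤ 2 * m - k') :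
    2 * B ≤ Real.pi * (2 * m + 2) * (‖m * M k m‖ * ‖M k' m‖) := by
  obtain ⟨i, rfl⟩ := hk
  obtain ⟨i', rfl⟩ := hk'.exists_two_nsmul
  simp only [smul_eq_mul] at *
  push_cast at hBk hBk'
  have hm : (0 : ℝ) < m := Nat.cast_pos.2 (by omega)
  have hx := hM.le_norm_sq_middle_column_two_mul_add_one (by omega) hBk
  have hy := hM.le_norm_sq_middle_column_two_mul (by omega) hBk'
  rw [← div_le_iff₀' hm, div_div] at hx hy
  have hxy := le_mul_of_le_sq_of_le_sq (norm_nonneg _) (norm_nonneg _) hx hy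
  rw [div_le_iff₀ (by positivity)] at hxy
  rw [norm_mul, Complex.norm_natCast]
  linear_combination 2 * hxy

lemma le_two_mul_ladderCoeff {n k : ℕ} (hk : k ≤ n) (hB : 0 ≤ B) (hBk : B ≤ k)
    (hBk' : B ≤ n - k) : B ≤ 2 * ladderCoeff n k := by
  refine le_of_sq_le_sq ?_ (mul_nonneg two_pos.le (ladderCoeff_nonneg n k))
  rw [two_mul_ladderCoeff_sq hk, sq]
  exact mul_le_mul hBk hBk' hB k.cast_nonneg

lemma le_norm_mul_norm_of_odd_dim (hM : IsOverlap (2 * m + 1) M) {k k' : ℕ} (hk : Odd k)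
    (hk' : Even k') (hkm : k < 2 * m + 1) (hkm' : k' < 2 * m + 1) (hB : 0 ≤ B) (hBk : B ≤ k)
    (hBk' : B ≤ 2 * m + 1 - k) :
    2 * B ≤ Real.pi * (2 * m + 2) *
      (‖ladderCoeff (2 * m + 1) k * M (k - 1) m‖ * ‖M k' m‖) := by
  obtain ⟨i, rfl⟩ := hk
  obtain ⟨i', rfl⟩ := hk'.exists_two_nsmul
  have hi : i ≤ m := by omega
  have hi' : i' ≤ m := by simp only [smul_eq_mul] at hkm'; omega
  rw [smul_eq_mul, Nat.add_sub_cancel, norm_mul, Complex.norm_real, Real.norm_eq_abs,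
    abs_of_nonneg (ladderCoeff_nonneg _ _)]
  have hxy := le_mul_of_le_sq_of_le_sq (norm_nonneg _) (norm_nonneg _)
    ((le_centralRatio_mul_sub hi).trans_eq (hM.norm_sq_middle_column_even hi).symm)
    ((le_centralRatio_mul_sub hi').trans_eq (hM.norm_sq_middle_column_even hi').symm)
  rw [div_le_iff₀ (by positivity)] at hxy
  calc 2 * B ≤ ‖M (2 * i) m‖ * ‖M (2 * i') m‖ * (Real.pi * (m + 1)) *
        (2 * ladderCoeff (2 * m + 1) (2 * i + 1)) :=
        mul_le_mul hxy (le_two_mul_ladderCoeff hkm.le hB hBk (by push_cast at hBk' ⊢; exact hBk'))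
          hB (by positivity)
    _ = _ := by ring

lemma exists_middleMinor_eq_mul {n : ℕ} (hM : IsOverlap n M) :
    ∃ g h : ℕ → ℂ, ∀ k k', Odd k → Even k' → k < n → k' < n →
      middleMinor n M k k' = g k * h k' ∧
      ∀ B : ℝ, 0 ≤ B → B ≤ k → B ≤ n - k → B ≤ n - k' →
        2 * B ≤ Real.pi * (n + 2) * (‖g k‖ * ‖h k'‖) := by
  rcases Nat.even_or_odd' n with ⟨m, rfl | rfl⟩
  · refine ⟨fun k => m * M k m, fun k' => conj (M k' m), fun k k' hk hk' hkn hkn' =>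
      ⟨hM.middleMinor_of_even_dim hk hk' hkn hkn', fun B _ hBk _ hBk' => ?_⟩⟩
    rw [RCLike.norm_conj]
    push_cast at hBk' ⊢
    exact hM.le_norm_mul_norm_of_even_dim hk hk' hkn hkn' hBk hBk'
  · refine ⟨fun k => ladderCoeff (2 * m + 1) k * M (k - 1) m, fun k' => conj (M k' m),
      fun k k' hk hk' hkn hkn' =>
      ⟨hM.middleMinor_of_odd_dim hk hkn k', fun B hB hBk hBk' _ => ?_⟩⟩
    rw [RCLike.norm_conj]
    push_cast at hBk' ⊢
    refine (hM.le_norm_mul_norm_of_odd_dim hk hk' hkn hkn' hB hBk hBk').trans ?_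
    gcongr
    linarith

end IsOverlap

end Factorization

section Projection

variable {E : Type*} [NormedAddCommGroup E] [InnerProductSpace ℂ E]

lemma aeval_apply_of_apply_eq_smul {A : E →L[ℂ] E} {v : E} {a : ℝ} (hv : A v = (a : ℂ) • v)
    (q : Polynomial ℝ) : Polynomial.aeval A q v = ((q.eval a : ℝ) : ℂ) • v := by
  induction q using Polynomial.induction_on with
  | C r => rw [Polynomial.aeval_C, Polynomial.eval_C, Algebra.algebraMap_eq_smul_one]; rfl
  | add p q hp hq => simp [hp, hq, add_smul]
  | monomial m r ih =>
    rw [pow_succ, ← mul_assoc, map_mul, Polynomial.aeval_X, mul_apply_eq_comp, hv, map_smul, ih,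
      smul_smul, ← Complex.ofReal_mul, Polynomial.eval_mul_X, mul_comm]

lemma norm_lie_le_half {P Q : E →L[ℂ] E} (hP : ‖(2 : ℝ) • P - 1‖ ≤ 1)
    (hQ : ‖(2 : ℝ) • Q - 1‖ ≤ 1) : ‖⁅P, Q⁆‖ ≤ 1 / 2 := by
  set A := (2 : ℝ) • P - 1 with hA
  set B := (2 : ℝ) • Q - 1 with hB
  have hlie : ⁅P, Q⁆ = (1 / 4 : ℝ) • ⁅A, B⁆ := by
    simp only [hA, hB, Ring.lie_def, mul_sub, sub_mul, smul_mul_smul_comm, mul_one, one_mul]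
    module
  have hAB : ‖A * B‖ ≤ 1 := (norm_mul_le _ _).trans (mul_le_one₀ hP (norm_nonneg _) hQ)
  have hBA : ‖B * A‖ ≤ 1 := (norm_mul_le _ _).trans (mul_le_one₀ hQ (norm_nonneg _) hP)
  calc ‖⁅P, Q⁆‖ = 1 / 4 * ‖A * B - B * A‖ := by
        rw [hlie, norm_smul, Ring.lie_def, Real.norm_of_nonneg (by norm_num)]
    _ ≤ 1 / 4 * (1 + 1) := by
        gcongr
        exact (norm_sub_le _ _).trans (add_le_add hAB hBA)
    _ = 1 / 2 := by norm_num

variable [CompleteSpace E] [FiniteDimensional ℂ E]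

lemma finite_spectrum_real (A : E →L[ℂ] E) : (spectrum ℝ A).Finite := by
  have h : (spectrum ℂ A).Finite := by
    rw [ContinuousLinearMap.spectrum_eq]
    exact Module.End.finite_spectrum _
  rw [← spectrum.preimage_algebraMap ℂ]
  exact h.preimage (FaithfulSMul.algebraMap_injective ℝ ℂ).injOn

-- On a finite spectrum every function agrees with an interpolating polynomial.
lemma cfc_apply_of_apply_eq_smul {A : E →L[ℂ] E} (hA : IsSelfAdjoint A) {v : E} {a : ℝ}
    (hv : A v = (a : ℂ) • v) (f : ℝ → ℝ) : cfc f A v = (f a : ℂ) • v := by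
  classical
  let s : Finset ℝ := insert a (finite_spectrum_real A).toFinset
  let q := Lagrange.interpolate s id f
  have hq : ∀ x ∈ s, q.eval x = f x := fun x hx =>
    Lagrange.eval_interpolate_at_node (v := id) f (Set.injOn_id _) hx
  have hcfc : cfc f A = Polynomial.aeval A q := by
    rw [← cfc_polynomial q A hA]
    exact cfc_congr fun x hx => (hq x (Finset.mem_insert_of_mem (by simpa using hx))).symm
  rw [hcfc, aeval_apply_of_apply_eq_smul hv, hq a (Finset.mem_insert_self _ _)]

lemma positiveProjection_apply_of_apply_eq_smul {A : E →L[ℂ] E} (hA : IsSelfAdjoint A) {v : E}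
    {a : ℝ} (hv : A v = (a : ℂ) • v) : positiveProjection A v = if 0 < a then v else 0 := by
  rw [positiveProjection, cfc_apply_of_apply_eq_smul hA hv, Set.indicator_apply]
  split_ifs <;> simp_all

lemma norm_two_smul_positiveProjection_sub_one_le {A : E →L[ℂ] E} (hA : IsSelfAdjoint A) :
    ‖(2 : ℝ) • positiveProjection A - 1‖ ≤ 1 := by
  have hc (f : ℝ → ℝ) : ContinuousOn f (spectrum ℝ A) := (finite_spectrum_real A).continuousOn f
  rw [positiveProjection, ← cfc_const_mul _ _ _ (hc _), ← cfc_const_one ℝ A,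
    ← cfc_sub _ _ _ (hc _) (hc _)]
  refine norm_cfc_le zero_le_one fun x _ => ?_
  rw [Set.indicator_apply]
  split_ifs <;> norm_num

end Projection

section Kernel

variable {E : Type*} [NormedAddCommGroup E] [InnerProductSpace ℂ E]
  {n : ℕ} {X Y Z : E →L[ℂ] E} {e f : ℕ → E}

namespace IsWeightBasis

lemma inner_eq (he : IsWeightBasis n X Y Z e) {l : ℕ} (hl : l < n) (k : ℕ) :
    inner ℂ (e k) (e l) = if k = l then 1 else 0 := by
  rcases lt_or_ge k n with hk | hk
  · simpa using (orthonormal_iff_ite.1 he.orthonormal) ⟨k, hk⟩ ⟨l, hl⟩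
  · rw [he.zero_of_le k hk, inner_zero_left, if_neg (by omega)]

lemma top_le_span (he : IsWeightBasis n X Y Z e) :
    ⊤ ≤ Submodule.span ℂ (Set.range fun k : Fin n => e k) := by
  rw [← he.span_eq_top, Submodule.span_le]
  rintro _ ⟨k, rfl⟩
  rcases lt_or_ge k n with hk | hk
  · exact Submodule.subset_span ⟨⟨k, hk⟩, rfl⟩
  · rw [he.zero_of_le k hk]
    exact zero_mem _

lemma sum_sq_norm_inner (he : IsWeightBasis n X Y Z e) (x : E) :
    ∑ k ∈ Finset.range n, ‖inner ℂ (e k) x‖ ^ 2 = ‖x‖ ^ 2 := by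
  rw [Finset.sum_range,
    ← (OrthonormalBasis.mk he.orthonormal he.top_le_span).sum_sq_norm_inner_right]
  simp

end IsWeightBasis

lemma weight_pos_iff {k : ℕ} : 0 < weight n k ↔ (n + 1) / 2 ≤ k := by
  have : ((n : ℝ) < k * 2 + 1) ↔ n < k * 2 + 1 := by exact_mod_cast Iff.rfl
  rw [weight, sub_pos, div_lt_iff₀ two_pos, sub_lt_iff_lt_add, this]
  omega

variable [CompleteSpace E]

lemma isOverlap_inner (hn : 0 < n) (h : IsSpinTriple X Y Z) (he : IsWeightBasis n X Y Z e)
    (hf : IsWeightBasis n Z (-Y) X f) : IsOverlap n (fun k l => inner ℂ (e k) (f l)) where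
  left k l := by
    have h : inner ℂ (X (e k)) (f l) = inner ℂ (e k) (X (f l)) := h.isSelfAdjoint_X.isSymmetric _ _
    rw [he.apply_X, hf.apply_Z, inner_add_left, inner_smul_left, inner_smul_left,
      inner_smul_right, Complex.conj_ofReal, Complex.conj_ofReal] at h
    exact h.symm
  right k l := by
    have h : inner ℂ (Z (e k)) (f l) = inner ℂ (e k) (Z (f l)) := h.isSelfAdjoint_Z.isSymmetric _ _
    rw [he.apply_Z, hf.apply_X, inner_add_right, inner_smul_left, inner_smul_right,
      inner_smul_right, Complex.conj_ofReal] at h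
    exact h
  mixed k l := by
    have h : inner ℂ (Y (e k)) (f l) = inner ℂ (e k) (-((-Y) (f l))) := by
      rw [neg_apply, neg_neg]
      exact h.isSelfAdjoint_Y.isSymmetric _ _
    rw [he.apply_Y, hf.apply_Y, inner_neg_right, inner_smul_left, inner_smul_right,
      inner_sub_left, inner_sub_right, inner_smul_left, inner_smul_left, inner_smul_right,
      inner_smul_right, Complex.conj_ofReal, Complex.conj_ofReal, map_neg, Complex.conj_I] at h
    apply mul_left_cancel₀ Complex.I_ne_zero
    linear_combination h
  sum_norm_sq := by
    have hf0 : ‖f 0‖ = 1 := hf.orthonormal.1 ⟨0, hn⟩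
    rw [he.sum_sq_norm_inner, hf0, one_pow]

variable [FiniteDimensional ℂ E]

lemma IsWeightBasis.positiveProjection_apply (hZ : IsSelfAdjoint Z)
    (he : IsWeightBasis n X Y Z e) (k : ℕ) :
    positiveProjection Z (e k) = if (n + 1) / 2 ≤ k then e k else 0 := by
  simp only [positiveProjection_apply_of_apply_eq_smul hZ (he.apply_Z k), weight_pos_iff]

lemma IsWeightBasis.lie_positiveProjection (hZ : IsSelfAdjoint Z) (he : IsWeightBasis n X Y Z e) :
    ⁅X, positiveProjection Z⁆ = (ladderCoeff n ((n + 1) / 2) : ℂ) •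
      (InnerProductSpace.rankOne ℂ (e ((n + 1) / 2 - 1)) (e ((n + 1) / 2)) -
        InnerProductSpace.rankOne ℂ (e ((n + 1) / 2)) (e ((n + 1) / 2 - 1))) := by
  apply ContinuousLinearMap.coe_injective
  refine LinearMap.ext_on_range (top_le_iff.1 he.top_le_span) fun ⟨k, hk⟩ => ?_
  obtain ⟨a, ha⟩ : ∃ a, (n + 1) / 2 = a + 1 := ⟨(n + 1) / 2 - 1, by omega⟩
  simp only [ContinuousLinearMap.coe_coe, Ring.lie_def, sub_apply, smul_apply, mul_apply_eq_comp,
    InnerProductSpace.rankOne_apply, he.inner_eq hk, he.positiveProjection_apply hZ, he.apply_X,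
    map_add, map_smul, ha, Nat.add_sub_cancel]
  rcases lt_trichotomy k a with h | rfl | h
  · rw [if_neg (by omega), if_neg (by omega), if_neg (by omega), if_neg (by omega),
      if_neg (by omega)]
    simp
  · rw [if_neg (by omega), if_pos (by omega), if_neg (by omega), if_neg (by omega), if_pos rfl]
    simp
  · rcases Nat.eq_or_lt_of_le h with rfl | h'
    · rw [if_pos le_rfl, if_pos (by omega), if_neg (by omega), if_pos rfl, if_neg (by omega),
        he.apply_X]
      simp
    · rw [if_pos (by omega), if_pos (by omega), if_pos (by omega), if_neg (by omega),
        if_neg (by omega), he.apply_X]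
      simp

lemma sub_mul_inner_positiveProjection (hX : IsSelfAdjoint X) (hZ : IsSelfAdjoint Z)
    (he : IsWeightBasis n X Y Z e) (hf : IsWeightBasis n Z (-Y) X f) (k k' : ℕ) :
    ((k : ℂ) - k') * inner ℂ (e k) (positiveProjection X (e k')) =
      middleMinor n (fun k l => inner ℂ (e k) (f l)) k k' := by
  have hlie : inner ℂ (e k) (⁅Z, positiveProjection X⁆ (e k')) =
      ((weight n k : ℂ) - weight n k') * inner ℂ (e k) (positiveProjection X (e k')) := by
    have hZsymm : inner ℂ (Z (e k)) (positiveProjection X (e k')) =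
      inner ℂ (e k) (Z (positiveProjection X (e k'))) := hZ.isSymmetric _ _
    rw [Ring.lie_def, sub_apply, mul_apply_eq_comp, mul_apply_eq_comp, inner_sub_right, ← hZsymm,
      he.apply_Z, he.apply_Z, inner_smul_left, map_smul, inner_smul_right, Complex.conj_ofReal]
    ring
  have hweight : (k : ℂ) - k' = weight n k - weight n k' := by
    exact_mod_cast (congrArg Complex.ofReal (weight_sub n k k')).symm
  rw [hweight, ← hlie, hf.lie_positiveProjection hX, middleMinor, inner_conj_symm, inner_conj_symm]
  simp only [smul_apply, sub_apply, InnerProductSpace.rankOne_apply, inner_smul_right,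
    inner_sub_right]
  ring

lemma inner_lie_positiveProjection (hZ : IsSelfAdjoint Z) (he : IsWeightBasis n X Y Z e)
    {k k' : ℕ} (hk : n ≤ 2 * k) (hk' : 2 * k' < n) :
    inner ℂ (e k) (⁅positiveProjection X, positiveProjection Z⁆ (e k')) =
      -inner ℂ (e k) (positiveProjection X (e k')) := by
  have hP' : positiveProjection Z (e k') = 0 := by
    rw [he.positiveProjection_apply hZ, if_neg (by omega)]
  have hP : positiveProjection Z (e k) = e k := by
    rw [he.positiveProjection_apply hZ, if_pos (by omega)]
  have hsymm : inner ℂ (positiveProjection Z (e k)) (positiveProjection X (e k')) =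
      inner ℂ (e k) (positiveProjection Z (positiveProjection X (e k'))) :=
    IsSelfAdjoint.isSymmetric (cfc_predicate _ Z) _ _
  rw [Ring.lie_def, sub_apply, mul_apply_eq_comp, mul_apply_eq_comp, hP', map_zero, zero_sub,
    inner_neg_right, ← hsymm, hP]

end Kernel

section HilbertMatrix

lemma arctan_le_self {x : ℝ} (hx : 0 ≤ x) : Real.arctan x ≤ x := by
  rcases hx.eq_or_lt with rfl | h
  · rw [Real.arctan_zero]
  · simpa using Real.le_tan (Real.arctan_pos.2 h).le (Real.arctan_lt_pi_div_two x)

lemma pi_div_two_sub_inv_le_arctan {x : ℝ} (hx : 0 < x) :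
    Real.pi / 2 - x⁻¹ ≤ Real.arctan x := by
  linarith [Real.arctan_inv_of_pos hx, arctan_le_self (inv_nonneg.2 hx.le)]

variable {b y : ℝ}

lemma hasDerivAt_arctan_sqrt_div (hb : 0 < b) {x : ℝ} (hx : 0 < x) :
    HasDerivAt (fun x => 2 / b * Real.arctan (√x / b)) (1 / (√x * (x + b ^ 2))) x := by
  refine (((Real.hasDerivAt_sqrt hx.ne').div_const b).arctan.const_mul (2 / b)).congr_deriv ?_
  rw [div_pow, Real.sq_sqrt hx.le]
  field_simp
  ring

lemma arctan_sub_arctan_le_sum (hb : 0 < b) (hy : 0 < y) (L : ℕ) :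
    2 / b * Real.arctan (√(y + L) / b) - 2 / b * Real.arctan (√y / b) ≤
      ∑ s ∈ Finset.range L, 1 / (√(y + s) * (y + s + b ^ 2)) := by
  have hyL : y ≤ y + L := le_add_of_nonneg_right L.cast_nonneg
  have hanti : AntitoneOn (fun x => 1 / (√x * (x + b ^ 2))) (Set.Icc y (y + L)) := by
    intro u hu v _ huv
    have hu0 : 0 < u := hy.trans_le hu.1
    dsimp only
    gcongr
  have hint := intervalIntegral.integral_eq_sub_of_hasDerivAt
    (fun x hx => hasDerivAt_arctan_sqrt_div hb (hy.trans_le (Set.uIcc_of_le hyL ▸ hx).1))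
    (Set.uIcc_of_le hyL ▸ hanti).intervalIntegrable
  exact hint ▸ hanti.integral_le_sum

lemma le_sum_one_div_sqrt_mul_add (hb : 0 < b) (hy : 0 < y) (L : ℕ) :
    Real.pi / b - 2 / √(y + L) - 2 * √y / b ^ 2 ≤
      ∑ s ∈ Finset.range L, 1 / (√(y + s) * (y + s + b ^ 2)) := by
  have hL : Real.pi / 2 - (√(y + L) / b)⁻¹ ≤ Real.arctan (√(y + L) / b) :=
    pi_div_two_sub_inv_le_arctan (by positivity)
  have h0 : Real.arctan (√y / b) ≤ √y / b := arctan_le_self (by positivity)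
  calc Real.pi / b - 2 / √(y + L) - 2 * √y / b ^ 2
      = 2 / b * (Real.pi / 2 - (√(y + L) / b)⁻¹) - 2 / b * (√y / b) := by
        field_simp
    _ ≤ 2 / b * Real.arctan (√(y + L) / b) - 2 / b * Real.arctan (√y / b) := by gcongr
    _ ≤ _ := arctan_sub_arctan_le_sum hb hy L

lemma one_div_sqrt_le_sqrt_add_one_sub_sqrt (hy : 0 < y) :
    1 / √y ≤ (2 + 1 / y) * (√(y + 1) - √y) := by
  have hsq : √y ^ 2 = y := Real.sq_sqrt hy.le
  have hsq' : √(y + 1) ^ 2 = y + 1 := Real.sq_sqrt (by positivity)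
  have hle : √y ≤ √(y + 1) := Real.sqrt_le_sqrt (by linarith)
  have hconj : (√(y + 1) + √y) * (√(y + 1) - √y) = 1 := by linear_combination hsq' - hsq
  have hmean : √y * (√(y + 1) + √y) ≤ 2 * y + 1 := by
    linarith [two_mul_le_add_sq √y √(y + 1)]
  calc 1 / √y = √y * (√(y + 1) + √y) / y * (√(y + 1) - √y) := by
        rw [← Real.sqrt_div_self', mul_div_right_comm, mul_assoc, hconj, mul_one]
    _ ≤ (2 * y + 1) / y * (√(y + 1) - √y) := by gcongr
    _ = _ := by field_simp

lemma sum_one_div_sqrt_le (hy : 0 < y) (L : ℕ) :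
    ∑ t ∈ Finset.range L, 1 / √(y + t) ≤ (2 + 1 / y) * √(y + L) := by
  induction L with
  | zero => simp only [Finset.range_zero, Finset.sum_empty]; positivity
  | succ L ih =>
    have hyL : 0 < y + L := by positivity
    have hle : 1 / (y + L) ≤ 1 / y := by
      gcongr
      exact le_add_of_nonneg_right L.cast_nonneg
    have hsub : 0 ≤ √(y + L + 1) - √(y + L) := sub_nonneg.2 (Real.sqrt_le_sqrt (by linarith))
    rw [Finset.sum_range_succ]
    push_cast
    rw [← add_assoc]
    linarith [one_div_sqrt_le_sqrt_add_one_sub_sqrt hyL,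
      mul_le_mul_of_nonneg_right (add_le_add_right hle 2) hsub]

lemma summable_one_div_mul_sqrt (hy : 0 < y) :
    Summable fun t : ℕ => 1 / ((y + t) * √(y + t)) := by
  refine ((Real.summable_one_div_nat_add_rpow y (3 / 2)).2 (by norm_num)).congr fun t => ?_
  have hyt : 0 < t + y := by positivity
  rw [abs_of_pos hyt, show (3 / 2 : ℝ) = 1 + 1 / 2 by norm_num, Real.rpow_add hyt, Real.rpow_one,
    ← Real.sqrt_eq_rpow, add_comm]

lemma tendsto_sum_one_div_add_atTop (hy : 0 < y) :
    Filter.Tendsto (fun L => ∑ t ∈ Finset.range L, 1 / (y + t)) Filter.atTop Filter.atTop := by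
  refine (not_summable_iff_tendsto_nat_atTop_of_nonneg fun t => by positivity).1 fun h => ?_
  refine lt_irrefl (1 : ℝ) ((Real.summable_one_div_nat_add_rpow y 1).1 (h.congr fun t => ?_))
  rw [abs_of_pos (by positivity), Real.rpow_one, add_comm]

/-- The quadratic form of the Hilbert-type matrix `1 / (2 * y + s + t)`, `s, t < L`, at the vector
`1 / √(y + s)`. Its squared norm is `∑ 1 / (y + s)`, so that this vector shows the norms of these
matrices to approach `π`. -/
noncomputable def hilbertForm (y : ℝ) (L : ℕ) : ℝ :=
  ∑ s ∈ Finset.range L, ∑ t ∈ Finset.range L,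
    1 / √(y + s) * (1 / √(y + t)) * (1 / (2 * y + s + t))

lemma hilbertForm_eq (hy : 0 < y) (L : ℕ) :
    hilbertForm y L = ∑ t ∈ Finset.range L, 1 / √(y + t) *
      ∑ s ∈ Finset.range L, 1 / (√(y + s) * (y + s + √(y + t) ^ 2)) := by
  rw [hilbertForm, Finset.sum_comm]
  refine Finset.sum_congr rfl fun t _ => ?_
  rw [Finset.mul_sum]
  refine Finset.sum_congr rfl fun s _ => ?_
  rw [Real.sq_sqrt (by positivity), show y + s + (y + t) = 2 * y + s + t by ring,
    ← one_div_mul_one_div]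
  ring

lemma exists_pi_mul_sum_sub_le_hilbertForm (hy : 0 < y) :
    ∃ K, ∀ L, Real.pi * ∑ t ∈ Finset.range L, 1 / (y + t) - K ≤ hilbertForm y L := by
  refine ⟨2 * (2 + 1 / y) + 2 * √y * ∑' t : ℕ, 1 / ((y + t) * √(y + t)), fun L => ?_⟩
  have hrow (t : ℕ) : Real.pi * (1 / (y + t)) - 2 / √(y + L) * (1 / √(y + t))
      - 2 * √y * (1 / ((y + t) * √(y + t))) ≤
      1 / √(y + t) * ∑ s ∈ Finset.range L, 1 / (√(y + s) * (y + s + √(y + t) ^ 2)) := by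
    have hyt : 0 < y + t := by positivity
    have hsqrt : 0 < √(y + t) := Real.sqrt_pos.2 hyt
    refine le_trans (le_of_eq ?_)
      (mul_le_mul_of_nonneg_left (le_sum_one_div_sqrt_mul_add hsqrt hy L) (by positivity))
    rw [← Real.sq_sqrt hyt.le, Real.sqrt_sq hsqrt.le]
    field_simp
  have hsum := Finset.sum_le_sum (s := Finset.range L) fun t _ => hrow t
  rw [← hilbertForm_eq hy, Finset.sum_sub_distrib, Finset.sum_sub_distrib, ← Finset.mul_sum,
    ← Finset.mul_sum, ← Finset.mul_sum] at hsum
  have hboundary : 2 / √(y + L) * ∑ t ∈ Finset.range L, 1 / √(y + t) ≤ 2 * (2 + 1 / y) := by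
    calc _ ≤ 2 / √(y + L) * ((2 + 1 / y) * √(y + L)) := by
          gcongr
          exact sum_one_div_sqrt_le hy L
      _ = _ := by field_simp
  have htail : 2 * √y * ∑ t ∈ Finset.range L, 1 / ((y + t) * √(y + t)) ≤
      2 * √y * ∑' t : ℕ, 1 / ((y + t) * √(y + t)) := by
    gcongr
    exact (summable_one_div_mul_sqrt hy).sum_le_tsum _ fun t _ => by positivity
  linarith

lemma exists_mul_sum_le_hilbertForm (hy : 0 < y) {a : ℝ} (ha : a < Real.pi) :
    ∃ L, 0 < L ∧ a * ∑ t ∈ Finset.range L, 1 / (y + t) ≤ hilbertForm y L := by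
  obtain ⟨K, hK⟩ := exists_pi_mul_sum_sub_le_hilbertForm hy
  obtain ⟨L, hL0, hL⟩ := ((Filter.eventually_gt_atTop 0).and
    ((tendsto_sum_one_div_add_atTop hy).eventually_ge_atTop (K / (Real.pi - a)))).exists
  refine ⟨L, hL0, le_trans ?_ (hK L)⟩
  rw [div_le_iff₀ (sub_pos.2 ha)] at hL
  linarith

end HilbertMatrix

section TestVectors

variable {𝕜 E F ι κ : Type*} [RCLike 𝕜] [NormedAddCommGroup E] [InnerProductSpace 𝕜 E]
  [NormedAddCommGroup F] [InnerProductSpace 𝕜 F] [Fintype ι] [Fintype κ]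
  {v : ι → E} {w : κ → F}

lemma norm_sum_smul_eq_sqrt (hv : Orthonormal 𝕜 v) (a : ι → 𝕜) :
    ‖∑ s, a s • v s‖ = √(∑ s, ‖a s‖ ^ 2) := by
  rw [← Real.sqrt_sq (norm_nonneg _)]
  congr 1
  rw [← RCLike.ofReal_inj (K := 𝕜), RCLike.ofReal_pow, ← inner_self_eq_norm_sq_to_K,
    hv.inner_sum]
  push_cast
  exact Finset.sum_congr rfl fun s _ => RCLike.conj_mul _

lemma norm_sum_sum_mul_inner_le (hv : Orthonormal 𝕜 v) (hw : Orthonormal 𝕜 w) (T : F →L[𝕜] E)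
    (a : ι → 𝕜) (c : κ → 𝕜) :
    ‖∑ s, ∑ t, conj (a s) * c t * inner 𝕜 (v s) (T (w t))‖ ≤
      ‖T‖ * (√(∑ s, ‖a s‖ ^ 2) * √(∑ t, ‖c t‖ ^ 2)) := by
  have hinner : ∑ s, ∑ t, conj (a s) * c t * inner 𝕜 (v s) (T (w t)) =
      inner 𝕜 (∑ s, a s • v s) (T (∑ t, c t • w t)) := by
    simp only [sum_inner, map_sum]
    refine Finset.sum_congr rfl fun s _ => ?_
    rw [inner_sum]
    refine Finset.sum_congr rfl fun t _ => ?_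
    rw [map_smul, inner_smul_left, inner_smul_right, mul_assoc]
  rw [hinner, ← norm_sum_smul_eq_sqrt hv, ← norm_sum_smul_eq_sqrt hw]
  calc _ ≤ ‖∑ s, a s • v s‖ * (‖T‖ * ‖∑ t, c t • w t‖) :=
        (norm_inner_le_norm _ _).trans (by gcongr; exact T.le_opNorm _)
    _ = _ := by ring

-- The phases of `g` and `h` can be absorbed into the coefficients of the test vectors.
lemma sum_sum_mul_norm_le (hv : Orthonormal 𝕜 v) (hw : Orthonormal 𝕜 w) {T : F →L[𝕜] E}
    {r : ι → κ → ℝ} {g : ι → 𝕜} {h : κ → 𝕜}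
    (hT : ∀ s t, inner 𝕜 (v s) (T (w t)) = r s t * (g s * h t)) (α : ι → ℝ) (β : κ → ℝ) :
    ∑ s, ∑ t, α s * β t * (r s t * (‖g s‖ * ‖h t‖)) ≤
      ‖T‖ * (√(∑ s, α s ^ 2) * √(∑ t, β t ^ 2)) := by
  choose u hu hug using fun s => RCLike.exists_norm_eq_mul_self (g s)
  choose z hz hzh using fun t => RCLike.exists_norm_eq_mul_self (h t)
  have key := norm_sum_sum_mul_inner_le hv hw T (fun s => conj (α s * u s)) (fun t => β t * z t)
  have hsum : ∑ s, ∑ t, conj (conj (α s * u s)) * (β t * z t) * inner 𝕜 (v s) (T (w t)) =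
      ((∑ s, ∑ t, α s * β t * (r s t * (‖g s‖ * ‖h t‖)) : ℝ) : 𝕜) := by
    push_cast
    refine Finset.sum_congr rfl fun s _ => Finset.sum_congr rfl fun t _ => ?_
    rw [hT, RCLike.conj_conj]
    calc _ = (α s : 𝕜) * β t * (r s t * (u s * g s * (z t * h t))) := by ring
      _ = _ := by rw [← hug, ← hzh]
  rw [hsum, RCLike.norm_ofReal] at key
  simp only [RCLike.norm_conj, norm_mul, hu, hz, mul_one, RCLike.norm_ofReal, sq_abs] at key
  exact (le_abs_self _).trans key

end TestVectors

section Commutator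

/-- The odd indices of weight vectors above the middle of `0, …, n - 1`, in increasing order. -/
def upperIndex (n s : ℕ) : ℕ := 2 * (n / 4 + 1 + s) + 1

/-- The even indices of weight vectors below the middle of `0, …, n - 1`, in decreasing order; the
truncated subtraction is harmless for `t < n / 4`. -/
def lowerIndex (n t : ℕ) : ℕ := 2 * (n / 4 - 1 - t)

lemma upperIndex_eq_lowerIndex_add {n s t : ℕ} (ht : t < n / 4) :
    upperIndex n s = lowerIndex n t + (2 * (s + t) + 5) := by
  unfold upperIndex lowerIndex
  omega

variable {E : Type*} [NormedAddCommGroup E] [InnerProductSpace ℂ E]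
  {n L : ℕ} {X Y Z : E →L[ℂ] E} {e f : ℕ → E}

lemma IsWeightBasis.orthonormal_upperIndex (hL : 4 * L + 8 ≤ n) (he : IsWeightBasis n X Y Z e) :
    Orthonormal ℂ fun s : Fin L => e (upperIndex n s) :=
  he.orthonormal.comp (fun s : Fin L => ⟨upperIndex n s, by unfold upperIndex; omega⟩)
    fun s t hst => by
      simp only [upperIndex, Fin.mk.injEq] at hst
      omega

lemma IsWeightBasis.orthonormal_lowerIndex (hL : 4 * L + 8 ≤ n) (he : IsWeightBasis n X Y Z e) :
    Orthonormal ℂ fun t : Fin L => e (lowerIndex n t) :=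
  he.orthonormal.comp (fun t : Fin L => ⟨lowerIndex n t, by unfold lowerIndex; omega⟩)
    fun s t hst => by
      simp only [lowerIndex, Fin.mk.injEq] at hst
      omega

lemma IsOverlap.exists_middleMinor_eq_mul_le {M : ℕ → ℕ → ℂ} (hL : 4 * L + 8 ≤ n)
    (hM : IsOverlap n M) :
    ∃ g h : ℕ → ℂ, ∀ s < L, ∀ t,
      middleMinor n M (upperIndex n s) (lowerIndex n t) = g s * h t ∧
      (n - (4 * L + 8)) / (Real.pi * (n + 2)) ≤ ‖g s‖ * ‖h t‖ := by
  obtain ⟨g, h, hgh⟩ := hM.exists_middleMinor_eq_mul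
  refine ⟨fun s => g (upperIndex n s), fun t => h (lowerIndex n t), fun s hs t => ?_⟩
  have hupper : n ≤ 2 * upperIndex n s := by unfold upperIndex; omega
  have hupper' : 2 * upperIndex n s ≤ n + 4 * L + 2 := by unfold upperIndex; omega
  have hlower : 2 * lowerIndex n t ≤ n := by unfold lowerIndex; omega
  obtain ⟨hmul, hle⟩ := hgh (upperIndex n s) (lowerIndex n t) ⟨_, rfl⟩ (even_two_mul _)
    (by omega) (by omega)
  refine ⟨hmul, (div_le_iff₀' (by positivity)).2 ?_⟩
  rify at hupper hupper' hlower hL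
  linarith [hle ((n - (4 * L + 8)) / 2) (by linarith) (by linarith) (by linarith) (by linarith)]

variable [CompleteSpace E] [FiniteDimensional ℂ E]

lemma exists_inner_lie_positiveProjection_eq (hL : 4 * L + 8 ≤ n) (h : IsSpinTriple X Y Z)
    (he : IsWeightBasis n X Y Z e) (hf : IsWeightBasis n Z (-Y) X f) :
    ∃ g h : ℕ → ℂ, ∀ s < L, ∀ t < L,
      inner ℂ (e (upperIndex n s)) (⁅positiveProjection X, positiveProjection Z⁆
        (e (lowerIndex n t))) = ((1 / 2 * (1 / (2 * (5 / 4) + s + t)) : ℝ) : ℂ) * (g s * h t) ∧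
      (n - (4 * L + 8)) / (Real.pi * (n + 2)) ≤ ‖g s‖ * ‖h t‖ := by
  obtain ⟨g, h', hgh⟩ := (isOverlap_inner (by omega) h he hf).exists_middleMinor_eq_mul_le hL
  refine ⟨fun s => -g s, h', fun s hs t ht => ⟨?_, norm_neg (g s) ▸ (hgh s hs t).2⟩⟩
  have hmul := sub_mul_inner_positiveProjection h.isSelfAdjoint_X h.isSelfAdjoint_Z he hf
    (upperIndex n s) (lowerIndex n t)
  rw [(hgh s hs t).1] at hmul
  set c : ℝ := 2 * (5 / 4) + s + t with hc
  have hsub : (upperIndex n s : ℂ) - lowerIndex n t = 2 * c := by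
    rw [upperIndex_eq_lowerIndex_add (s := s) (show t < n / 4 by omega), hc]
    push_cast
    ring
  have hc0 : (c : ℂ) ≠ 0 := Complex.ofReal_ne_zero.2 (by positivity)
  rw [hsub] at hmul
  rw [inner_lie_positiveProjection h.isSelfAdjoint_Z he (by unfold upperIndex; omega)
    (by unfold lowerIndex; omega), neg_mul, ← hmul]
  push_cast
  field_simp

lemma mul_hilbertForm_le_norm_lie_positiveProjection (hL : 4 * L + 8 ≤ n)
    (h : IsSpinTriple X Y Z) (he : IsWeightBasis n X Y Z e) (hf : IsWeightBasis n Z (-Y) X f) :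
    (n - (4 * L + 8)) / (Real.pi * (n + 2)) * (1 / 2 * hilbertForm (5 / 4) L) ≤
      ‖⁅positiveProjection X, positiveProjection Z⁆‖ *
        ∑ t ∈ Finset.range L, 1 / (5 / 4 + t : ℝ) := by
  obtain ⟨g, h', hgh⟩ := exists_inner_lie_positiveProjection_eq hL h he hf
  have key := sum_sum_mul_norm_le (he.orthonormal_upperIndex hL) (he.orthonormal_lowerIndex hL)
    (r := fun s t => 1 / 2 * (1 / (2 * (5 / 4) + s + t))) (fun s t => (hgh s s.2 t t.2).1)
    (fun s => 1 / √(5 / 4 + s)) (fun t => 1 / √(5 / 4 + t))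
  have hsq (t : Fin L) : (1 / √(5 / 4 + t : ℝ)) ^ 2 = 1 / (5 / 4 + t) := by
    rw [div_pow, one_pow, Real.sq_sqrt (by positivity)]
  simp only [hsq] at key
  rw [Real.mul_self_sqrt (by positivity), ← Finset.sum_range fun t : ℕ => 1 / (5 / 4 + t : ℝ)]
    at key
  refine le_trans ?_ key
  simp only [hilbertForm, Finset.sum_range, Finset.mul_sum]
  refine Finset.sum_le_sum fun s _ => Finset.sum_le_sum fun t _ => ?_
  rw [mul_left_comm (1 / 2), mul_left_comm, mul_comm (_ / (_ * _))]
  gcongr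
  exact (hgh s s.2 t t.2).2

lemma IsIrreducibleSpinTriple.mul_le_norm_lie_positiveProjection
    (h : IsIrreducibleSpinTriple X Y Z) (hL0 : 0 < L) (hL : 4 * L + 8 ≤ Module.finrank ℂ E)
    {b : ℝ} (hb : 2 * Real.pi * b * ∑ t ∈ Finset.range L, 1 / (5 / 4 + t : ℝ) ≤
      hilbertForm (5 / 4) L) :
    (Module.finrank ℂ E - (4 * L + 8)) / (Module.finrank ℂ E + 2) * b ≤
      ‖⁅positiveProjection X, positiveProjection Z⁆‖ := by
  obtain ⟨e, he⟩ := h.exists_isWeightBasis (by omega)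
  obtain ⟨f, hf⟩ := h.rotate.exists_isWeightBasis (by omega)
  have hsum : 0 < ∑ t ∈ Finset.range L, 1 / (5 / 4 + t : ℝ) :=
    Finset.sum_pos (fun t _ => by positivity) ⟨0, Finset.mem_range.2 hL0⟩
  refine le_of_mul_le_mul_right ?_ hsum
  refine le_trans ?_ (mul_hilbertForm_le_norm_lie_positiveProjection hL h.toIsSpinTriple he hf)
  rify at hL
  calc _ = (Module.finrank ℂ E - (4 * L + 8)) / (Real.pi * (Module.finrank ℂ E + 2)) *
        (1 / 2 * (2 * Real.pi * b * ∑ t ∈ Finset.range L, 1 / (5 / 4 + t : ℝ))) := by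
        field_simp
    _ ≤ _ := by gcongr

lemma tendsto_natCast_sub_div_add (c d : ℝ) :
    Filter.Tendsto (fun n : ℕ => (n - c) / (n + d)) Filter.atTop (nhds 1) := by
  simpa [neg_add_eq_sub, add_comm d] using
    tendsto_add_mul_div_add_mul_atTop_nhds (-c) d 1 one_ne_zero

end Commutator

end SpinCommutator

theorem theorem2_general {ι : Type*} {l : Filter ι} (E : ι → Type*)
    [∀ i, NormedAddCommGroup (E i)] [∀ i, InnerProductSpace ℂ (E i)] [∀ i, CompleteSpace (E i)]
    (X Y Z : ∀ i, E i →L[ℂ] E i)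
    (hdim : Filter.Tendsto (fun i => Module.finrank ℂ (E i)) l Filter.atTop)
    (hspin : ∀ᶠ i in l, SpinCommutator.IsIrreducibleSpinTriple (X i) (Y i) (Z i)) :
    Filter.Tendsto (fun i => ‖⁅SpinCommutator.positiveProjection (X i),
      SpinCommutator.positiveProjection (Z i)⁆‖) l (nhds (1 / 2)) := by
  refine tendsto_order.2 ⟨fun a ha => ?_, fun a ha => ?_⟩
  · obtain ⟨b, hab, hb⟩ := exists_between ha
    obtain ⟨L, hL0, hL⟩ := SpinCommutator.exists_mul_sum_le_hilbertForm (y := 5 / 4) (by norm_num)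
      (show 2 * Real.pi * b < Real.pi by nlinarith [Real.pi_pos])
    have hlim := ((SpinCommutator.tendsto_natCast_sub_div_add (4 * L + 8) 2).mul_const b).comp hdim
    filter_upwards [hlim.eventually_const_lt (one_mul b ▸ hab), hspin,
      hdim.eventually_ge_atTop (4 * L + 8)] with i hi h hLi
    have := FiniteDimensional.of_finrank_pos (by omega : 0 < Module.finrank ℂ (E i))
    exact hi.trans_le (h.mul_le_norm_lie_positiveProjection hL0 hLi hL)
  · filter_upwards [hspin, hdim.eventually_gt_atTop 0] with i h hi
    have := FiniteDimensional.of_finrank_pos hi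
    exact (SpinCommutator.norm_lie_le_half
      (SpinCommutator.norm_two_smul_positiveProjection_sub_one_le h.isSelfAdjoint_X)
      (SpinCommutator.norm_two_smul_positiveProjection_sub_one_le h.isSelfAdjoint_Z)).trans_lt ha

theorem theorem2 (E : ℕ → Type*) [∀ n, NormedAddCommGroup (E n)]
    [∀ n, InnerProductSpace ℂ (E n)] [∀ n, CompleteSpace (E n)]
    (ρ : ∀ n, SpinCommutator.SU2 →* unitary (E n →L[ℂ] E n))
    (hdim : ∀ n, 1 ≤ n → Module.finrank ℂ (E n) = n)
    (hdiff : ∀ n, 1 ≤ n → SpinCommutator.IsDifferentiable (ρ n))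
    (hirr : ∀ n, 1 ≤ n → (SpinCommutator.toRepresentation (ρ n)).IsIrreducible) :
    Filter.Tendsto (fun n => ‖SpinCommutator.C (ρ n)‖) Filter.atTop (nhds (1 / 2)) := by
  have hge := Filter.eventually_ge_atTop 1
  refine theorem2_general E _ (fun n => SpinCommutator.J (ρ n) 1) _
    (Filter.tendsto_id.congr' (hge.mono fun n hn => (hdim n hn).symm)) (hge.mono fun n hn => ?_)
  have := FiniteDimensional.of_finrank_pos (hn.trans_eq (hdim n hn).symm)
  exact SpinCommutator.isIrreducibleSpinTriple_J (hdiff n hn) (hirr n hn)
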